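/- Let $n \ge 4$ and $r \ge 2$ be integers with $n \ge r+2$. For $1\le\alpha\le n$ let $F^{(\alpha)}_r$ be a free group with basis $a^{(\alpha)}_1,\dots,a^{(\alpha)}_r$, and let $K = K^n_r(r)$ be the kernel of the homomorphism $\psi\colon F^{(1)}_r\times\cdots\times F^{(n)}_r\to\mathbb Z^r$ sending each $a^{(\alpha)}_j$ to the $j$-th standard basis vector $e_j$. For $1\le\alpha\le n-1$ and $1\le i\le r$ put $x^{(\alpha)}_i = a^{(\alpha)}_i (a^{(n)}_i)^{-1}\in K$. Let $\mathcal X$ be the set of all the letters $x^{(\alpha)}_i$, let $F(\mathcal X)$ be the abstract free group on $\mathcal X$ with word length $|\cdot|$, and let $\mathcal R=\mathcal R_1\cup\mathcal R_2\subset F(\mathcal X)$, where, with $[g,h]=ghg^{-1}h^{-1}$, $$\mathcal R_1=\{[x^{(\alpha)}_i,x^{(\beta)}_i] : 1\le i\le r,\ \alpha\ne\beta\},\qquad \mathcal R_2=\{[x^{(\alpha)}_i,x^{(\beta)}_j(x^{(\gamma)}_j)^{-1}] : i\neq j,\ \alpha,\beta,\gamma \text{ pairwise distinct}\}$$ (upper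 indices in $\{1,\dots,n-1\}$). For $w\in F(\mathcal X)$ let $\mathrm{Area}(w)\in\mathbb N\cup\{\infty\}$ be the least $M$ such that $w=\prod_{k=1}^M u_k^{-1}R_ku_k$ in $F(\mathcal X)$ with $u_k\in F(\mathcal X)$ and $R_k\in\mathcal R$ (and $\infty$ if there is no such $M$; allowing $R_k\in\mathcal R\cup\mathcal R^{-1}$ gives the same number, since the inverse of each relator is conjugate to a relator). A normal form of $g\in K$ is an element $w_g\in F(\mathcal X)$ representing $g$ that can be written as $w_g=w_g^{\Delta}\, w_g^{(1)}w_g^{(2)}\cdots w_g^{(n-1)}$ with $w_g^{(\alpha)}\in F(x^{(\alpha)}_1,\dots,x^{(\alpha)}_r)$ for each $\alpha$ and $w_g^{\Delta}$ in the commutator subgroup of $F(x^{(1)}_1,x^{(2)}_2,\dots,x^{(r)}_r)$. Then $\langle\mathcal X\mid\mathcal R\rangle$ is a presentation of $K$, every $g\in K$ has a unique normal form $w_g$, and there is a constant $C>0$ (depending only on $n$ and $r$) such that for every $g\in K$ and every $w\in F(\mathcal X)$ representing $g$, $$\mathrm{Area}(w^{-1}w_g)\le C\,|w|^2 .$$ In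 particular the Dehn function $\delta(N)=\max\{\mathrm{Area}(w) : w\in F(\mathcal X),\ |w|\le N,\ w=_K 1\}$ of $K$ is quadratic: $\delta(N)\asymp N^2$, where $f\preccurlyeq g$ means that $f(N)\le C g(CN+C)+CN+C$ for all $N\in\mathbb N$, for some integer $C>0$, and $f\asymp g$ means $f\preccurlyeq g$ and $g\preccurlyeq f$. -/

import Mathlib

/-! ### Area and Dehn functions -/

namespace Dehn

/-- `area R w` is the least number `M` of factors in an expression of `w` as a product
`∏ uᵢ⁻¹ * Rᵢ * uᵢ` of conjugates of elements `Rᵢ ∈ R`, and `⊤` if there is no such expression.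
The pairs in the list `l` are the pairs `(uᵢ, Rᵢ)`. -/
noncomputable def area {S : Type*} (R : Set (FreeGroup S)) (w : FreeGroup S) : ℕ∞ :=
  sInf {M : ℕ∞ | ∃ l : List (FreeGroup S × FreeGroup S),
    (∀ p ∈ l, p.2 ∈ R) ∧ w = (l.map fun p => p.1⁻¹ * p.2 * p.1).prod ∧ M = (l.length : ℕ∞)}

/-- The homomorphism `φ` (evaluation of words in `G`) exhibits `⟨S | R⟩` as a presentation
of `G`. -/
def IsPresentation {S G : Type*} [Group G] (φ : FreeGroup S →* G) (R : Set (FreeGroup S)) : Prop :=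
  Function.Surjective φ ∧ φ.ker = Subgroup.normalClosure R

/-- The Dehn function: the supremum of the areas of the words `w` of length at most `N` with
`w = 1` in `G`. Here `FreeGroup.norm` is the length of the reduced word. -/
noncomputable def dehnFunction {S G : Type*} [DecidableEq S] [Group G] (φ : FreeGroup S →* G)
    (R : Set (FreeGroup S)) (N : ℕ) : ℕ∞ :=
  ⨆ w ∈ {w : FreeGroup S | w.norm ≤ N ∧ φ w = 1}, area R w

/-- `f ≼ g`: there is `C > 0` with `f(N) ≤ C g(CN + C) + CN + C` for all `N`. -/
def AsympLE (f g : ℕ → ℕ∞) : Prop :=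
  ∃ C : ℕ, 0 < C ∧ ∀ N : ℕ, f N ≤ (C : ℕ∞) * g (C * N + C) + (C : ℕ∞) * (N : ℕ∞) + (C : ℕ∞)

/-- `f ≍ g`. -/
def Asymp (f g : ℕ → ℕ∞) : Prop := AsympLE f g ∧ AsympLE g f

end Dehn

/-! ### The groups `K^n_r(r)`, their presentations and normal forms -/

namespace Coabelian

open scoped commutatorElement

/-- The ambient group: the direct product of `n` free groups of rank `r`. -/
abbrev Ambient (n r : ℕ) : Type := Fin n → FreeGroup (Fin r)

/-- The homomorphism `ψ` from the direct product to `ℤ^r` (written multiplicatively) that sends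
the `j`-th basis element of each factor to the `j`-th standard basis vector. -/
noncomputable def psi (n r : ℕ) : Ambient n r →* Multiplicative (Fin r → ℤ) :=
  ∏ α : Fin n,
    (FreeGroup.lift fun j : Fin r => Multiplicative.ofAdd (Pi.single j (1 : ℤ) : Fin r → ℤ)).comp
      (Pi.evalMonoidHom (fun _ : Fin n => FreeGroup (Fin r)) α)

/-- `K^n_r(r)`, the kernel of `ψ`. -/
noncomputable def K (n r : ℕ) : Subgroup (Ambient n r) := (psi n r).ker

/-- The `i`-th basis element `a_i^{(α)}` of the `α`-th factor. -/
def basisElt {n r : ℕ} (α : Fin n) (i : Fin r) : Ambient n r :=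
  Pi.mulSingle α (FreeGroup.of i)

theorem psi_basisElt {n r : ℕ} (α : Fin n) (i : Fin r) :
    psi n r (basisElt α i) = Multiplicative.ofAdd (Pi.single i (1 : ℤ) : Fin r → ℤ) := by
  unfold psi basisElt
  rw [MonoidHom.finsetProd_apply, Finset.prod_eq_single α]
  · simp
  · intro β _ hβ
    simp [Pi.mulSingle_eq_of_ne hβ]
  · simp

/-- The alphabet: the letter `(α, i)` stands for `x_i^{(α)}`, where `α` runs over the first
`n - 1` factors. -/
abbrev Letter (n r : ℕ) : Type := Fin (n - 1) × Fin r

/-- The element `x_i^{(α)} = a_i^{(α)} (a_i^{(n)})⁻¹` of `K^n_r(r)`. -/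
noncomputable def gen {n r : ℕ} (s : Letter n r) : K n r :=
  ⟨basisElt (⟨s.1, by have := s.1.2; omega⟩ : Fin n) s.2 *
      (basisElt (⟨n - 1, by have := s.1.2; omega⟩ : Fin n) s.2)⁻¹, by
    rw [K, MonoidHom.mem_ker, map_mul, map_inv, psi_basisElt, psi_basisElt, mul_inv_cancel]⟩

/-- Evaluation of words: the homomorphism from the free group on the letters to `K^n_r(r)`. -/
noncomputable def eval (n r : ℕ) : FreeGroup (Letter n r) →* K n r :=
  FreeGroup.lift gen

/-- The letter `x_i^{(α)}` as an element of the abstract free group. -/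
def x {n r : ℕ} (α : Fin (n - 1)) (i : Fin r) : FreeGroup (Letter n r) :=
  FreeGroup.of (α, i)

/-- The relators `[x_i^{(α)}, x_i^{(β)}]` with `α ≠ β`. -/
def relators₁ (n r : ℕ) : Set (FreeGroup (Letter n r)) :=
  {w | ∃ (i : Fin r) (α β : Fin (n - 1)), α ≠ β ∧ w = ⁅x α i, x β i⁆}

/-- The relators `[x_i^{(α)}, x_j^{(β)} (x_j^{(γ)})⁻¹]` with `i ≠ j` and `α, β, γ` pairwise
distinct. -/
def relators₂ (n r : ℕ) : Set (FreeGroup (Letter n r)) :=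
  {w | ∃ (i j : Fin r) (α β γ : Fin (n - 1)), i ≠ j ∧ α ≠ β ∧ α ≠ γ ∧ β ≠ γ ∧
    w = ⁅x α i, x β j * (x γ j)⁻¹⁆}

/-- All relators. -/
def relators (n r : ℕ) : Set (FreeGroup (Letter n r)) := relators₁ n r ∪ relators₂ n r

/-- The subgroup of words in the letters `x_1^{(α)}, …, x_r^{(α)}`, for a fixed `α`. -/
def blockSubgroup (n r : ℕ) (α : Fin (n - 1)) : Subgroup (FreeGroup (Letter n r)) :=
  Subgroup.closure {w | ∃ i : Fin r, w = x α i}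

/-- The subgroup of words in the diagonal letters `Δ = (x_1^{(1)}, …, x_r^{(r)})`. -/
def diagonalSubgroup (n r : ℕ) : Subgroup (FreeGroup (Letter n r)) :=
  Subgroup.closure {w | ∃ (α : Fin (n - 1)) (i : Fin r), (α : ℕ) = (i : ℕ) ∧ w = x α i}

/-- `v` is a normal form of `g`: it represents `g` and is an ordered product
`d * p 1 * p 2 * ⋯ * p (n - 1)` where `d` lies in the commutator subgroup of the free group on the
diagonal letters and each `p α` is a word in the letters `x_1^{(α)}, …, x_r^{(α)}`. -/
def IsNormalForm {n r : ℕ} (g : K n r) (v : FreeGroup (Letter n r)) : Prop :=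
  eval n r v = g ∧
    ∃ (d : FreeGroup (Letter n r)) (p : Fin (n - 1) → FreeGroup (Letter n r)),
      d ∈ ⁅diagonalSubgroup n r, diagonalSubgroup n r⁆ ∧
      (∀ α, p α ∈ blockSubgroup n r α) ∧
      v = d * (List.ofFn p).prod

end Coabelian

/-! Since x_i^{(α)} = a_i^{(α)} (a_i^{(n)})⁻¹, a word `w` evaluates to the element with coordinates
`retr α w` for α < n and, in the last factor, `forget w` with its letters inverted. These invariants
decide equality in `K`. A diagonal word in the commutator subgroup is killed by every `retr α`, so
the invariants of a normal form give back first its blocks and then its diagonal part (`defect`);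
hence existence and uniqueness.

For the upper bound, choose an injective colouring σ of the r letters that avoids α, and write
x_i^{(α)} as the ratio x_i^{(α)} (x_i^{(σ i)})⁻¹ times x_i^{(σ i)}. By the relators the ratios
commute with the letters coloured by σ, so a word in the colour α splits into a ratio word and a
recoloured word at quadratic cost (`near_split`, `near_color_split`). Three moves of cost O(N²)
result: changing the injective colouring of a word in the commutator subgroup (`near_color_color`),
conjugating such a word by a single-coloured one (`near_mono_mul_color_of_mem_commutator`), and
exchanging words of two different colours at the price of a diagonal commutator (`near_swap`). The
condition n ≥ r + 2 supplies the colours. With these moves a product of two normal forms is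
normalised at quadratic cost (`near_normalForm_mul_normalForm`), and halving a word recursively adds
up to a quadratic total (`near_normalForm`). Relators preserve the invariants, so it is enough to
reach some normal form: it must be the right one. A word trivial in `K` has normal form 1, which
gives the presentation as well.

For the lower bound, `K` is mapped on the level of words to the Heisenberg group, where each relator
contributes at most 1 to the central coordinate, while a commutator of N-th powers of two letters
contributes N². -/

namespace FreeGroup

/-! ### Word length in free groups -/

variable {A B : Type*} [DecidableEq A] [DecidableEq B]

/-- The counter in `p` is the length of an unreduced spelling, so the inductive steps need not
exclude cancellation. A reduced spelling then gives the value `u.norm`. -/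
theorem norm_induction {p : ℕ → FreeGroup A → Prop} (one : p 0 1)
    (of_mul : ∀ k a u, p k u → p (k + 1) (of a * u))
    (inv_mul : ∀ k a u, p k u → p (k + 1) ((of a)⁻¹ * u)) (u : FreeGroup A) : p u.norm u := by
  have key : ∀ L : List (A × Bool), p L.length (mk L) := by
    intro L
    induction L with
    | nil => exact one
    | cons s L ih =>
      obtain ⟨a, b⟩ := s
      have h : mk ((a, b) :: L) = mk [(a, b)] * mk L := by rw [mul_mk]; rfl
      rw [h, List.length_cons]
      cases b with
      | true => exact of_mul _ a _ ih
      | false =>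
        have : mk [(a, false)] = (of a)⁻¹ := by simp [of, inv_mk, invRev]
        rw [this]
        exact inv_mul _ a _ ih
  have := key u.toWord
  rwa [mk_toWord] at this

theorem norm_hom_le (f : FreeGroup A →* FreeGroup B) (hf : ∀ a, (f (of a)).norm ≤ 1)
    (u : FreeGroup A) : (f u).norm ≤ u.norm := by
  refine norm_induction (p := fun k u => (f u).norm ≤ k) (by simp) ?_ ?_ u
  · intro k a u h
    have := norm_mul_le (f (of a)) (f u)
    have := hf a
    rw [_root_.map_mul]
    omega
  · intro k a u h
    have := norm_mul_le (f (of a))⁻¹ (f u)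
    have := hf a
    rw [_root_.map_mul, _root_.map_inv]
    have h3 : ((f (of a))⁻¹).norm = (f (of a)).norm := norm_inv_eq
    omega

theorem norm_conj_le (u v : FreeGroup A) : (u * v * u⁻¹).norm ≤ 2 * u.norm + v.norm := by
  have h1 := norm_mul_le (u * v) u⁻¹
  have h2 := norm_mul_le u v
  have h3 : (u⁻¹).norm = u.norm := norm_inv_eq
  omega

theorem exists_mul_eq_of_norm (w : FreeGroup A) (k : ℕ) :
    ∃ u v : FreeGroup A, w = u * v ∧ u.norm ≤ k ∧ v.norm ≤ w.norm - k := by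
  refine ⟨mk (w.toWord.take k), mk (w.toWord.drop k), ?_, ?_, ?_⟩
  · rw [mul_mk, List.take_append_drop, mk_toWord]
  · refine norm_mk_le.trans ?_
    simp
  · refine norm_mk_le.trans ?_
    simp [norm]

end FreeGroup

/-! ### Calculus of area bounds -/

namespace Dehn

variable {S : Type*} {R : Set (FreeGroup S)}

/-- `w` is a product of at most `M` conjugates of elements of `R`. -/
def AreaLE (R : Set (FreeGroup S)) (M : ℕ) (w : FreeGroup S) : Prop :=
  ∃ l : List (FreeGroup S × FreeGroup S),
    (∀ p ∈ l, p.2 ∈ R) ∧ w = (l.map fun p => p.1⁻¹ * p.2 * p.1).prod ∧ l.length ≤ M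

theorem AreaLE.mono {M M' : ℕ} {w : FreeGroup S} (h : AreaLE R M w) (hM : M ≤ M') :
    AreaLE R M' w := by
  obtain ⟨l, h1, h2, h3⟩ := h
  exact ⟨l, h1, h2, h3.trans hM⟩

theorem AreaLE.area_le {M : ℕ} {w : FreeGroup S} (h : AreaLE R M w) : area R w ≤ M := by
  obtain ⟨l, h1, h2, h3⟩ := h
  have : area R w ≤ (l.length : ℕ∞) := sInf_le ⟨l, h1, h2, rfl⟩
  exact this.trans (by exact_mod_cast h3)

theorem areaLE_one (R : Set (FreeGroup S)) : AreaLE R 0 1 :=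
  ⟨[], by simp, by simp, by simp⟩

theorem areaLE_of_mem {w : FreeGroup S} (h : w ∈ R) : AreaLE R 1 w :=
  ⟨[(1, w)], by simpa using h, by simp, by simp⟩

theorem AreaLE.mul {M M' : ℕ} {w w' : FreeGroup S} (h : AreaLE R M w) (h' : AreaLE R M' w') :
    AreaLE R (M + M') (w * w') := by
  obtain ⟨l, h1, h2, h3⟩ := h
  obtain ⟨l', h1', h2', h3'⟩ := h'
  refine ⟨l ++ l', ?_, ?_, ?_⟩
  · intro p hp
    rcases List.mem_append.1 hp with hp | hp
    exacts [h1 p hp, h1' p hp]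
  · simp [h2, h2']
  · simp
    omega

theorem AreaLE.conj {M : ℕ} {w : FreeGroup S} (h : AreaLE R M w) (u : FreeGroup S) :
    AreaLE R M (u⁻¹ * w * u) := by
  obtain ⟨l, h1, rfl, h3⟩ := h
  refine ⟨l.map fun p => (p.1 * u, p.2), ?_, ?_, by simpa using h3⟩
  · intro p hp
    obtain ⟨q, hq, rfl⟩ := List.mem_map.1 hp
    exact h1 q hq
  · clear h1 h3
    induction l with
    | nil => simp
    | cons p l ih =>
      simp only [List.map_cons, List.prod_cons] at ih ⊢
      rw [← ih]
      group

theorem AreaLE.inv (hR : ∀ ρ ∈ R, AreaLE R 1 ρ⁻¹) {M : ℕ} {w : FreeGroup S} (h : AreaLE R M w) :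
    AreaLE R M w⁻¹ := by
  obtain ⟨l, h1, rfl, h3⟩ := h
  refine AreaLE.mono ?_ h3
  clear h3
  induction l with
  | nil => simpa using areaLE_one R
  | cons p l ih =>
    simp only [List.map_cons, List.prod_cons, mul_inv_rev, List.length_cons]
    refine (ih fun q hq => h1 q (List.mem_cons_of_mem _ hq)).mul ?_
    have := (hR p.2 (h1 p List.mem_cons_self)).conj p.1
    convert this using 1
    group

theorem area_ne_top {w : FreeGroup S} (h : area R w ≠ ⊤) : w ∈ Subgroup.normalClosure R := by
  by_contra hw
  apply h
  rw [area, sInf_eq_top]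
  rintro M ⟨l, h1, h2, -⟩
  exfalso
  apply hw
  rw [h2]
  apply Subgroup.list_prod_mem
  intro y hy
  obtain ⟨p, hp, rfl⟩ := List.mem_map.1 hy
  have := (Subgroup.normalClosure_normal (s := R)).conj_mem _
    (Subgroup.subset_normalClosure (h1 p hp)) p.1⁻¹
  simpa using this

end Dehn

/-! ### Rewriting by relators at bounded cost -/

namespace Coabelian

open Dehn FreeGroup

open scoped commutatorElement

variable {n r : ℕ}

/-- Inverting a commutator of the first kind exchanges its two entries. For the second kind, [g,
t]⁻¹ is a conjugate of [g, t⁻¹], and t⁻¹ is again a ratio, with β and γ exchanged. Hence `Near` is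
symmetric without any loss. -/
theorem areaLE_inv_relators (ρ : FreeGroup (Letter n r)) (h : ρ ∈ relators n r) :
    AreaLE (relators n r) 1 ρ⁻¹ := by
  rcases h with ⟨i, α, β, hne, rfl⟩ | ⟨i, j, α, β, γ, hij, h1, h2, h3, rfl⟩
  · rw [commutatorElement_inv]
    exact areaLE_of_mem (Or.inl ⟨i, β, α, hne.symm, rfl⟩)
  · have := (areaLE_of_mem (R := relators n r)
      (Or.inr ⟨i, j, α, γ, β, hij, h2, h1, h3.symm, rfl⟩)).conj (x β j * (x γ j)⁻¹)⁻¹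
    convert this using 1
    simp only [commutatorElement_def]
    group

/-- The words `u` and `v` differ by at most `M` applications of relators. -/
def Near (M : ℕ) (u v : FreeGroup (Letter n r)) : Prop := AreaLE (relators n r) M (u⁻¹ * v)

namespace Near

variable {M M' : ℕ} {u v w u' v' : FreeGroup (Letter n r)}

theorem mono (h : Near M u v) (hM : M ≤ M') : Near M' u v := AreaLE.mono h hM

theorem of_eq (h : u = v) : Near 0 u v := by
  subst h
  simpa [Near] using areaLE_one _

theorem refl (u : FreeGroup (Letter n r)) : Near 0 u u := of_eq rfl

theorem symm (h : Near M u v) : Near M v u := by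
  have := AreaLE.inv areaLE_inv_relators h
  simpa [Near] using this

theorem trans (h : Near M u v) (h' : Near M' v w) : Near (M + M') u w := by
  have := AreaLE.mul h h'
  simpa [Near, mul_assoc] using this

theorem mul_left (h : Near M u v) (w : FreeGroup (Letter n r)) : Near M (w * u) (w * v) := by
  simpa [Near, mul_assoc] using h

theorem mul_right (h : Near M u v) (w : FreeGroup (Letter n r)) : Near M (u * w) (v * w) := by
  have := AreaLE.conj h w
  simpa [Near, mul_assoc] using this

theorem mul (h : Near M u v) (h' : Near M' u' v') : Near (M + M') (u * u') (v * v') :=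
  (h.mul_right u').trans (h'.mul_left v)

end Near

/-- The words `u` and `v` commute after at most `M` applications of relators. -/
def NearComm (M : ℕ) (u v : FreeGroup (Letter n r)) : Prop := Near M (u * v) (v * u)

namespace NearComm

variable {M M' : ℕ} {u v w u' v' : FreeGroup (Letter n r)}

theorem mono (h : NearComm M u v) (hM : M ≤ M') : NearComm M' u v := Near.mono h hM

theorem symm (h : NearComm M u v) : NearComm M v u := Near.symm h

theorem of_commute (h : Commute u v) : NearComm 0 u v := Near.of_eq h

theorem inv_right (h : NearComm M u v) : NearComm M u v⁻¹ := by
  have := ((Near.symm h).mul_left v⁻¹).mul_right v⁻¹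
  simp only [mul_assoc, inv_mul_cancel_left, mul_inv_cancel, mul_one] at this
  exact this

theorem mul_right (h : NearComm M u v) (h' : NearComm M' u w) : NearComm (M + M') u (v * w) := by
  have h1 := Near.mul_right h w
  have h2 := Near.mul_left h' v
  simp only [mul_assoc] at h1 h2
  have := h1.trans h2
  simpa only [NearComm, mul_assoc] using this

theorem inv_left (h : NearComm M u v) : NearComm M u⁻¹ v := h.symm.inv_right.symm

theorem mul_left (h : NearComm M u v) (h' : NearComm M' w v) : NearComm (M + M') (u * w) v :=
  (h.symm.mul_right h'.symm).symm

theorem hom_right {A : Type*} [DecidableEq A] (g : FreeGroup A →* FreeGroup (Letter n r))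
    (h : ∀ a, NearComm M u (g (of a))) (w : FreeGroup A) : NearComm (M * w.norm) u (g w) := by
  refine norm_induction (p := fun k w => NearComm (M * k) u (g w)) ?_ ?_ ?_ w
  · rw [_root_.map_one]
    exact of_commute (Commute.one_right u)
  · intro k a w hw
    rw [_root_.map_mul]
    exact ((h a).mul_right hw).mono (by ring_nf; rfl)
  · intro k a w hw
    rw [_root_.map_mul, _root_.map_inv]
    exact ((h a).inv_right.mul_right hw).mono (by ring_nf; rfl)

theorem hom {A B : Type*} [DecidableEq A] [DecidableEq B]
    (f : FreeGroup A →* FreeGroup (Letter n r)) (g : FreeGroup B →* FreeGroup (Letter n r))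
    (h : ∀ a b, NearComm M (f (of a)) (g (of b))) (u : FreeGroup A) (w : FreeGroup B) :
    NearComm (M * u.norm * w.norm) (f u) (g w) := by
  refine hom_right g (fun b => ?_) w
  exact (hom_right f (fun a => (h a b).symm) u).symm

end NearComm

/-- If the letters of `f` and `g` commute at bounded cost, then the words of the pointwise product
split at quadratic cost. -/
theorem near_split {A : Type*} [DecidableEq A] {M : ℕ}
    (f g h : FreeGroup A →* FreeGroup (Letter n r))
    (hfg : ∀ a b, NearComm M (f (of a)) (g (of b))) (hh : ∀ a, h (of a) = f (of a) * g (of a))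
    (u : FreeGroup A) : Near (M * u.norm ^ 2) (h u) (f u * g u) := by
  -- The counter may exceed the length of an intermediate word, so `u.norm ≤ k` is carried along. A
  -- new letter of `g` must pass `f u`, which costs `M * k`, and an inverse letter costs `M` more;
  -- both fit into M((k + 1)² - k²).
  refine (norm_induction
    (p := fun k u => u.norm ≤ k ∧ Near (M * k ^ 2) (h u) (f u * g u)) ?_ ?_ ?_ u).2
  · simpa using (Near.refl (1 : FreeGroup (Letter n r)))
  · rintro k a u ⟨hk, hu⟩
    refine ⟨?_, ?_⟩
    · have := norm_mul_le (of a) u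
      rw [norm_of] at this
      omega
    have h1 : NearComm (M * k) (g (of a)) (f u) :=
      (NearComm.hom_right f (fun b => (hfg b a).symm) u).mono (Nat.mul_le_mul_left _ hk)
    have h2 := hu.mul_left (h (of a))
    have h3 := (Near.mul_left h1 (f (of a))).mul_right (g u)
    simp only [_root_.map_mul, hh, mul_assoc] at h2 h3 ⊢
    refine (h2.trans h3).mono ?_
    nlinarith [Nat.zero_le (M * k)]
  · rintro k a u ⟨hk, hu⟩
    refine ⟨?_, ?_⟩
    · have := norm_mul_le (of a)⁻¹ u
      have h3 : ((of a)⁻¹).norm = (of a).norm := norm_inv_eq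
      rw [h3, norm_of] at this
      omega
    have h1 : NearComm (M * k) (g (of a))⁻¹ (f u) := NearComm.inv_left
      ((NearComm.hom_right f (fun b => (hfg b a).symm) u).mono (Nat.mul_le_mul_left _ hk))
    have h0 : NearComm M (g (of a))⁻¹ (f (of a))⁻¹ := (hfg a a).symm.inv_left.inv_right
    have h2 := hu.mul_left (h (of a))⁻¹
    have h3 := (Near.mul_left h1 (f (of a))⁻¹).mul_right (g u)
    have h4 := Near.mul_right h0 (f u * g u)
    simp only [_root_.map_mul, _root_.map_inv, hh, mul_inv_rev, mul_assoc] at h2 h3 h4 ⊢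
    refine ((h2.trans h4).trans h3).mono ?_
    nlinarith [Nat.zero_le (M * k)]

theorem near_of_relator {u v : FreeGroup (Letter n r)} (h : ⁅u, v⁆ ∈ relators n r) :
    NearComm 1 u v := by
  refine Near.symm ?_
  have := (areaLE_of_mem h).conj (v * u)
  refine (congrArg (AreaLE (relators n r) 1) ?_).mp this
  rw [commutatorElement_def]
  group

theorem nearComm_same (α β : Fin (n - 1)) (i : Fin r) : NearComm 1 (x α i) (x β i) := by
  by_cases h : α = β
  · subst h
    exact (NearComm.of_commute (Commute.refl _)).mono (by omega)
  · exact near_of_relator (Or.inl ⟨i, α, β, h, rfl⟩)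

/-- The letter `x_i^{(α)}` commutes with the ratio of two letters of index `j`, provided that
`i = j` or `α` is a third colour. -/
theorem nearComm_ratio (α β γ : Fin (n - 1)) (i j : Fin r) (h : i ≠ j → α ≠ β ∧ α ≠ γ) :
    NearComm 2 (x α i) (x β j * (x γ j)⁻¹) := by
  by_cases hij : i = j
  · subst hij
    exact (nearComm_same α β i).mul_right (nearComm_same α γ i).inv_right
  · by_cases hβ : β = γ
    · subst hβ
      rw [mul_inv_cancel]
      exact (NearComm.of_commute (Commute.one_right _)).mono (by omega)
    · exact (near_of_relator (Or.inr ⟨i, j, α, β, γ, hij, (h hij).1, (h hij).2, hβ, rfl⟩)).mono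
        (by omega)

/-! ### Colourings and recolouring -/

/-- The word obtained from a word in `r` letters by giving the colour `τ i` to the `i`-th letter. -/
def color (τ : Fin r → Fin (n - 1)) : FreeGroup (Fin r) →* FreeGroup (Letter n r) :=
  FreeGroup.lift fun i => x (τ i) i

/-- The word whose letters are the ratios of the letters for the colourings `τ` and `σ`. -/
def ratio (τ σ : Fin r → Fin (n - 1)) : FreeGroup (Fin r) →* FreeGroup (Letter n r) :=
  FreeGroup.lift fun i => x (τ i) i * (x (σ i) i)⁻¹

@[simp] theorem color_of (τ : Fin r → Fin (n - 1)) (i : Fin r) : color τ (of i) = x (τ i) i := by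
  simp [color]

@[simp] theorem ratio_of (τ σ : Fin r → Fin (n - 1)) (i : Fin r) :
    ratio τ σ (of i) = x (τ i) i * (x (σ i) i)⁻¹ := by
  simp [ratio]

/-- The word in the single colour `α`. -/
def mono (α : Fin (n - 1)) : FreeGroup (Fin r) →* FreeGroup (Letter n r) := color fun _ => α

@[simp] theorem mono_of (α : Fin (n - 1)) (i : Fin r) : mono α (of i) = x α i := by
  simp [mono]

/-- Where the colourings agree the ratio is trivial; elsewhere the hypothesis makes `σ i` a third
colour, and the case `i = j` needs only relators of the first kind. -/
theorem nearComm_ratio_color {τ σ : Fin r → Fin (n - 1)}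
    (h : ∀ i j, i ≠ j → τ j ≠ σ j → σ i ≠ τ j ∧ σ i ≠ σ j) (i j : Fin r) :
    NearComm 2 (ratio τ σ (of j)) (color σ (of i)) := by
  rw [ratio_of, color_of]
  by_cases hj : τ j = σ j
  · rw [hj, mul_inv_cancel]
    exact (NearComm.of_commute (Commute.one_left _)).mono (by omega)
  · exact (nearComm_ratio _ _ _ _ _ fun hij => h i j hij hj).symm

theorem near_color_split {τ σ : Fin r → Fin (n - 1)}
    (h : ∀ i j, i ≠ j → τ j ≠ σ j → σ i ≠ τ j ∧ σ i ≠ σ j) (u : FreeGroup (Fin r)) :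
    Near (2 * u.norm ^ 2) (color τ u) (ratio τ σ u * color σ u) :=
  near_split _ _ _ (fun i j => nearComm_ratio_color h j i) (by simp) u

theorem mono_separated {α : Fin (n - 1)} {σ : Fin r → Fin (n - 1)} (hσ : Function.Injective σ)
    (hα : ∀ i, σ i ≠ α) (i j : Fin r) (hij : i ≠ j) (_ : α ≠ σ j) : σ i ≠ α ∧ σ i ≠ σ j :=
  ⟨hα i, fun h => hij (hσ h)⟩

/-- A word in the colour `α` conjugates the words of an injective colouring that avoids `α` in
the same way as its recoloured version does. -/
theorem near_mono_mul_color {α : Fin (n - 1)} {σ : Fin r → Fin (n - 1)}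
    (hσ : Function.Injective σ) (hα : ∀ i, σ i ≠ α) (v w : FreeGroup (Fin r)) (N : ℕ)
    (hv : v.norm ≤ N) (hw : w.norm ≤ N) :
    Near (10 * N ^ 2) (mono α v * color σ w) (color σ (v * w * v⁻¹) * mono α v) := by
  have h1 := near_color_split (τ := fun _ => α) (mono_separated hσ hα) v
  have h2 : NearComm (2 * v.norm * (v * w * v⁻¹).norm) (ratio (fun _ => α) σ v)
      (color σ (v * w * v⁻¹)) := NearComm.hom _ _
    (fun i j => nearComm_ratio_color (τ := fun _ => α) (mono_separated hσ hα) j i) _ _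
  have h3 := h1.mul_right (color σ w)
  have h4 := Near.mul_right h2 (color σ v)
  have h5 := h1.symm.mul_left (color σ (v * w * v⁻¹))
  have e : color σ (v * w * v⁻¹) * color σ v = color σ v * color σ w := by
    rw [← _root_.map_mul, ← _root_.map_mul, inv_mul_cancel_right]
  simp only [mul_assoc] at h3 h4 h5
  rw [mul_assoc v] at e
  rw [e] at h4
  simp only [mul_assoc]
  -- Two splittings of `v` cost 2N² each; moving the ratio word past a conjugate of length at most
  -- 3N costs 6N².
  refine ((h3.trans h4).trans h5).mono ?_
  have h6 := norm_conj_le v w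
  rw [mul_assoc] at h6
  have h7 : v.norm ^ 2 ≤ N ^ 2 := Nat.pow_le_pow_left hv 2
  have h8 : v.norm * (v * (w * v⁻¹)).norm ≤ N * (3 * N) := Nat.mul_le_mul hv (by omega)
  nlinarith

/-- The retraction of a free group onto the powers of the `j`-th letter. -/
def expo (j : Fin r) : FreeGroup (Fin r) →* FreeGroup (Fin r) :=
  FreeGroup.lift fun i => if i = j then of j else 1

@[simp] theorem expo_of (i j : Fin r) : expo j (of i) = if i = j then of j else 1 := by
  simp [expo]

theorem expo_expo (j : Fin r) (u : FreeGroup (Fin r)) : expo j (expo j u) = expo j u := by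
  have : (expo j).comp (expo j) = expo j := by
    ext i
    by_cases h : i = j <;> simp [h]
  exact DFunLike.congr_fun this u

theorem expo_norm_le (j : Fin r) (u : FreeGroup (Fin r)) : (expo j u).norm ≤ u.norm := by
  refine norm_hom_le _ (fun i => ?_) u
  by_cases h : i = j <;> simp [h, norm_of]

theorem expo_commute (j : Fin r) (u v : FreeGroup (Fin r)) : Commute (expo j u) (expo j v) := by
  have : expo j = (zpowersHom _ (of j)).comp
      (FreeGroup.lift fun i => if i = j then Multiplicative.ofAdd (1 : ℤ) else 1) := by
    ext i
    by_cases h : i = j <;> simp [h]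
  rw [this]
  exact (Commute.all _ _).map (zpowersHom _ (of j))

theorem expo_of_mem_commutator (j : Fin r) {u : FreeGroup (Fin r)}
    (hu : u ∈ commutator (FreeGroup (Fin r))) : expo j u = 1 := by
  suffices h : commutator (FreeGroup (Fin r)) ≤ (expo j).ker from h hu
  rw [commutator_def, Subgroup.commutator_le]
  intro a _ b _
  rw [MonoidHom.mem_ker, map_commutatorElement, commutatorElement_eq_one_iff_commute]
  exact expo_commute j a b

/-- Recolouring of the `j`-th letter in a word of exponent zero in this letter. -/
theorem near_recolor {τ σ : Fin r → Fin (n - 1)} (j : Fin r) (hτσ : ∀ i, i ≠ j → τ i = σ i)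
    (h : ∀ i, i ≠ j → σ i ≠ τ j ∧ σ i ≠ σ j) {u : FreeGroup (Fin r)} (hu : expo j u = 1) :
    Near (2 * u.norm ^ 2) (color τ u) (color σ u) := by
  have h1 : Near (2 * u.norm ^ 2) (color τ u) (ratio τ σ u * color σ u) := by
    refine near_color_split (fun i k hik hk => ?_) u
    have hkj : k = j := by
      by_contra hne
      exact hk (hτσ k hne)
    subst hkj
    exact h i hik
  -- Only the `j`-th ratio is nontrivial, so the ratio word is a power of it whose exponent is the
  -- exponent sum of the letter `j`.
  have h2 : ratio τ σ = (ratio τ σ).comp (expo j) := by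
    ext i
    by_cases hij : i = j
    · simp [hij]
    · simp [hij, hτσ i hij]
  have h3 : ratio τ σ u = 1 := by
    rw [h2, MonoidHom.comp_apply, hu, _root_.map_one]
  rwa [h3, one_mul] at h1

/-- Any two injective colourings of a product of commutators agree at quadratic cost. -/
theorem near_color_color (hnr : r + 2 ≤ n) {τ σ : Fin r → Fin (n - 1)}
    (hτ : Function.Injective τ) (hσ : Function.Injective σ) {u : FreeGroup (Fin r)}
    (hu : u ∈ commutator (FreeGroup (Fin r))) :
    Near (4 * r * u.norm ^ 2) (color τ u) (color σ u) := by
  have key : ∀ k : ℕ, ∀ τ : Fin r → Fin (n - 1), Function.Injective τ →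
      (Finset.univ.filter fun i => τ i ≠ σ i).card ≤ k →
      Near (4 * k * u.norm ^ 2) (color τ u) (color σ u) := by
    intro k
    induction k with
    | zero =>
      intro τ hτ hk
      have : τ = σ := by
        funext i
        by_contra hi
        have : i ∈ Finset.univ.filter fun i => τ i ≠ σ i := by simpa using hi
        rw [Finset.card_eq_zero.1 (Nat.le_zero.1 hk)] at this
        simp at this
      rw [this]
      exact (Near.refl _).mono (by omega)
    | succ k ih =>
      intro τ hτ hk
      by_cases hall : τ = σ
      · rw [hall]
        exact (Near.refl _).mono (by omega)
      obtain ⟨j, hj⟩ := Function.ne_iff.1 hall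
      -- Recolour one letter `j` to a colour that is not used.
      have step : ∀ (τ : Fin r → Fin (n - 1)), Function.Injective τ → ∀ (j : Fin r)
          (c : Fin (n - 1)), (∀ i, τ i ≠ c) → Function.Injective (Function.update τ j c) ∧
          Near (2 * u.norm ^ 2) (color τ u) (color (Function.update τ j c) u) := by
        intro τ hτ j c hc
        refine ⟨?_, near_recolor j (fun i hi => by simp [hi]) (fun i hi => ?_)
          (expo_of_mem_commutator j hu)⟩
        · intro a b hab
          by_cases ha : a = j <;> by_cases hb : b = j
          · rw [ha, hb]
          · simp [ha, hb] at hab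
            exact absurd hab.symm (hc b)
          · simp [ha, hb] at hab
            exact absurd hab (hc a)
          · simp [ha, hb] at hab
            exact hτ hab
        · simp only [ne_eq, hi, not_false_eq_true, Function.update_of_ne, Function.update_self]
          exact ⟨fun h => hi (hτ h), hc i⟩
      by_cases hused : ∃ k, τ k = σ j
      · obtain ⟨k, hk'⟩ := hused
        have hkj : k ≠ j := by
          rintro rfl
          exact hj hk'
        -- The wanted colour `σ j` is occupied by `k`, so `k` is first moved to a spare colour,
        -- which exists as r < n - 1. Nothing is lost: injectivity of `σ` gives `τ k = σ j ≠ σ k`,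
        -- so `k` already disagreed with `σ`. Two recolourings per corrected letter give the factor
        -- 4.
        obtain ⟨c, hc⟩ : ∃ c, ∀ i, τ i ≠ c := by
          by_contra hcon
          push Not at hcon
          have := Fintype.card_le_of_surjective τ hcon
          simp at this
          omega
        obtain ⟨h1, h2⟩ := step τ hτ k c hc
        have hc' : ∀ i, Function.update τ k c i ≠ σ j := by
          intro i
          by_cases hi : i = k
          · subst hi
            simp only [Function.update_self]
            exact fun h => hc i (hk'.trans h.symm)
          · simp only [ne_eq, hi, not_false_eq_true, Function.update_of_ne]
            exact fun h => hi (hτ (h.trans hk'.symm))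
        obtain ⟨h3, h4⟩ := step _ h1 j (σ j) hc'
        refine ((h2.trans h4).trans (ih _ h3 ?_)).mono ?_
        · refine Nat.le_of_lt_succ (lt_of_lt_of_le (Finset.card_lt_card ?_) hk)
          refine Finset.ssubset_iff.2 ⟨j, by simp, ?_⟩
          intro i hi
          simp only [Finset.mem_insert, Finset.mem_filter, Finset.mem_univ, true_and] at hi ⊢
          rcases hi with rfl | hi
          · exact hj
          · by_cases hij : i = j
            · rw [hij]
              exact hj
            · by_cases hik : i = k
              · subst hik
                exact fun h => hij (hσ (h.symm.trans hk'))
              · simpa [hij, hik] using hi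
        · ring_nf
          rfl
      · push Not at hused
        obtain ⟨h3, h4⟩ := step τ hτ j (σ j) hused
        refine (h4.trans (ih _ h3 ?_)).mono ?_
        · refine Nat.le_of_lt_succ (lt_of_lt_of_le (Finset.card_lt_card ?_) hk)
          refine Finset.ssubset_iff.2 ⟨j, by simp, ?_⟩
          intro i hi
          simp only [Finset.mem_insert, Finset.mem_filter, Finset.mem_univ, true_and] at hi ⊢
          rcases hi with rfl | hi
          · exact hj
          · by_cases hij : i = j
            · rw [hij]
              exact hj
            · simpa [hij] using hi
        · nlinarith [Nat.zero_le (u.norm ^ 2)]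
  exact key r τ hτ ((Finset.card_le_univ _).trans (by simp))

/-! ### Exchanging words of two colours -/

/-- The word in the colour `α` whose letters other than the `j`-th are divided by their recoloured
versions. -/
def partialRatio (α : Fin (n - 1)) (τ : Fin r → Fin (n - 1)) (j : Fin r) :
    FreeGroup (Fin r) →* FreeGroup (Letter n r) :=
  FreeGroup.lift fun i => if i = j then x α j else x α i * (x (τ i) i)⁻¹

/-- Both sides split off the same full ratio word: `mono α` is ratio times `color τ`, and
`partialRatio` is ratio times the `j`-th letters of `color τ`. Comparing the remainders leaves a
factor of exponent zero in `j`, which can be recoloured. -/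
theorem near_mono_partialRatio {α : Fin (n - 1)} {τ : Fin r → Fin (n - 1)}
    (hτ : Function.Injective τ) (hα : ∀ i, τ i ≠ α) (j : Fin r) (u : FreeGroup (Fin r)) :
    Near (4 * u.norm ^ 2) (mono α u) (partialRatio α τ j u * color τ ((expo j u)⁻¹ * u)) := by
  have h1 := near_color_split (τ := fun _ => α) (mono_separated hτ hα) u
  have h2 : Near (2 * u.norm ^ 2) (partialRatio α τ j u)
      (ratio (fun _ => α) τ u * color τ (expo j u)) := by
    refine near_split _ ((color τ).comp (expo j)) _ (fun a b => ?_) (fun a => ?_) u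
    · by_cases hb : b = j
      · have := nearComm_ratio_color (τ := fun _ => α) (mono_separated hτ hα) b a
        simpa [hb] using this
      · simpa [hb] using (NearComm.of_commute (Commute.one_right
          (x α a * (x (τ a) a)⁻¹))).mono (Nat.zero_le 2)
    · by_cases ha : a = j <;> simp [partialRatio, ha]
  have h3 := h2.symm.mul_right (color τ ((expo j u)⁻¹ * u))
  rw [mul_assoc, ← _root_.map_mul, mul_inv_cancel_left] at h3
  exact (h1.trans h3).mono (by omega)

theorem norm_expo_inv_mul_le (j : Fin r) (u : FreeGroup (Fin r)) :
    ((expo j u)⁻¹ * u).norm ≤ 2 * u.norm := by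
  have h1 := norm_mul_le (expo j u)⁻¹ u
  have h2 : ((expo j u)⁻¹).norm = (expo j u).norm := norm_inv_eq
  have h3 := expo_norm_le j u
  omega

theorem expo_expo_inv_mul (j : Fin r) (u : FreeGroup (Fin r)) :
    expo j ((expo j u)⁻¹ * u) = 1 := by
  rw [_root_.map_mul, _root_.map_inv, expo_expo, inv_mul_cancel]

/-- The colourings `τ` and `σ` are injective, avoid `α` and `β`, respectively, and differ only
in the colour of the `j`-th letter. -/
structure Adapted (α β : Fin (n - 1)) (τ σ : Fin r → Fin (n - 1)) (j : Fin r) : Prop where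
  injective_left : Function.Injective τ
  injective_right : Function.Injective σ
  avoids_left : ∀ i, τ i ≠ α
  avoids_right : ∀ i, σ i ≠ β
  left_eq : τ j = β
  right_eq : σ j = α
  eq_of_ne : ∀ i, i ≠ j → τ i = σ i

theorem Adapted.symm {α β : Fin (n - 1)} {τ σ : Fin r → Fin (n - 1)} {j : Fin r}
    (h : Adapted α β τ σ j) : Adapted β α σ τ j :=
  ⟨h.2, h.1, h.4, h.3, h.6, h.5, fun i hi => (h.7 i hi).symm⟩

theorem Adapted.near_color {α β : Fin (n - 1)} {τ σ : Fin r → Fin (n - 1)} {j : Fin r}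
    (h : Adapted α β τ σ j) {u : FreeGroup (Fin r)} (hu : expo j u = 1) :
    Near (2 * u.norm ^ 2) (color τ u) (color σ u) := by
  refine near_recolor j h.eq_of_ne (fun i hi => ⟨?_, fun hij => hi (h.injective_right hij)⟩) hu
  rw [h.left_eq]
  exact h.avoids_right i

/-- When n = r + 2 only r - 1 colours lie outside {α, β}, too few for an injective colouring that
avoids both. Leaving the letter `j` undivided keeps the bad colours `τ j = β` and `σ j = α` out of
the ratios; then every pair of letters has either equal index or a third colour. -/
theorem Adapted.nearComm_partialRatio {α β : Fin (n - 1)} {τ σ : Fin r → Fin (n - 1)} {j : Fin r}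
    (h : Adapted α β τ σ j) (hαβ : α ≠ β) (u v : FreeGroup (Fin r)) :
    NearComm (4 * u.norm * v.norm) (partialRatio α τ j u) (partialRatio β σ j v) := by
  refine NearComm.hom _ _ (fun a b => ?_) u v
  by_cases ha : a = j <;> by_cases hb : b = j
  · simp only [partialRatio, lift_apply_of, ha, hb, if_true]
    exact (nearComm_same _ _ _).mono (by omega)
  · simp only [partialRatio, lift_apply_of, ha, hb, if_true, if_false]
    refine (nearComm_ratio _ _ _ _ _ fun _ => ⟨hαβ, ?_⟩).mono (by omega)
    rw [← h.eq_of_ne b hb]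
    exact (h.avoids_left b).symm
  · simp only [partialRatio, lift_apply_of, ha, hb, if_true, if_false]
    refine (nearComm_ratio _ _ _ _ _ fun _ => ⟨hαβ.symm, ?_⟩).symm.mono (by omega)
    rw [h.eq_of_ne a ha]
    exact (h.avoids_right a).symm
  · simp only [partialRatio, lift_apply_of, ha, hb, if_false]
    by_cases hab : a = b
    · subst hab
      exact (((nearComm_ratio _ _ _ _ _ (by simp)).mul_left
        (nearComm_ratio _ _ _ _ _ (by simp)).inv_left)).mono (by omega)
    · refine (NearComm.mul_right (M := 2) (M' := 2)
        (nearComm_ratio _ _ _ _ _ fun _ => ⟨hαβ.symm, ?_⟩).symm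
        (nearComm_ratio _ _ _ _ _ fun _ => ⟨?_, ?_⟩).symm.inv_right).mono (by omega)
      · rw [h.eq_of_ne a ha]
        exact (h.avoids_right a).symm
      · rw [← h.eq_of_ne b hb]
        exact h.avoids_left b
      · rw [← h.eq_of_ne b hb]
        exact fun hba => hab (h.injective_left hba).symm

/-- The zero-exponent remainder of `u` is recoloured from `τ` to `σ`. Since `σ` avoids `β`, it then
passes `mono β v` by conjugation, and finally `v` is split too. The costs are 4, 2·2², 10·4² and 4
times N². -/
theorem Adapted.near_mono_mul_mono {α β : Fin (n - 1)} {τ σ : Fin r → Fin (n - 1)} {j : Fin r}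
    (h : Adapted α β τ σ j) (u v : FreeGroup (Fin r)) (N : ℕ)
    (hu : u.norm ≤ N) (hv : v.norm ≤ N) :
    Near (176 * N ^ 2) (mono α u * mono β v)
      (partialRatio α τ j u * partialRatio β σ j v *
        color σ (((expo j v)⁻¹ * v) * v⁻¹ * ((expo j u)⁻¹ * u) * v)) := by
  have h1 := (near_mono_partialRatio h.injective_left h.avoids_left j u).mul_right (mono β v)
  have h2 := near_mono_partialRatio h.injective_right h.avoids_right j v
  have hu' := norm_expo_inv_mul_le j u
  have h3 := h.near_color (expo_expo_inv_mul j u)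
  have hc : (v⁻¹ * ((expo j u)⁻¹ * u) * v).norm ≤ 4 * N := by
    have := norm_conj_le v⁻¹ ((expo j u)⁻¹ * u)
    have h3 : (v⁻¹).norm = v.norm := norm_inv_eq
    rw [inv_inv] at this
    omega
  have h4 := (near_mono_mul_color h.injective_right h.avoids_right v
    (v⁻¹ * ((expo j u)⁻¹ * u) * v) (4 * N) (by omega) hc).symm
  generalize (expo j u)⁻¹ * u = u' at *
  generalize (expo j v)⁻¹ * v = v' at *
  have e1 : v * (v⁻¹ * u' * v) * v⁻¹ = u' := by group
  have e2 : v' * v⁻¹ * u' * v = v' * (v⁻¹ * u' * v) := by group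
  rw [e1] at h4
  rw [e2, _root_.map_mul]
  have h3' := (h3.mul_right (mono β v)).mul_left (partialRatio α τ j u)
  have h4' := h4.mul_left (partialRatio α τ j u)
  have h2' := (h2.mul_right (color σ (v⁻¹ * u' * v))).mul_left (partialRatio α τ j u)
  simp only [mul_assoc] at h1 h2' h3' h4' ⊢
  refine (((h1.trans h3').trans h4').trans h2').mono ?_
  have b1 : u.norm ^ 2 ≤ N ^ 2 := Nat.pow_le_pow_left hu 2
  have b2 : v.norm ^ 2 ≤ N ^ 2 := Nat.pow_le_pow_left hv 2
  have b3 : u'.norm ^ 2 ≤ (2 * N) ^ 2 := Nat.pow_le_pow_left (by omega) 2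
  nlinarith

/-- At least r colours differ from `α`; a transposition arranges that `j` receives `β`. Recolouring
`j` by `α` then frees `β`. -/
theorem exists_adapted (hnr : r + 2 ≤ n) {α β : Fin (n - 1)} (hαβ : α ≠ β) (j : Fin r) :
    ∃ τ σ, Adapted α β τ σ j := by
  have hcard : Fintype.card (Fin r) ≤ Fintype.card {c : Fin (n - 1) // c ≠ α} := by
    rw [Fintype.card_subtype_compl, Fintype.card_fin, Fintype.card_fin, Fintype.card_subtype_eq]
    omega
  obtain ⟨e⟩ := Function.Embedding.nonempty_of_card_le hcard
  let τ : Fin r → Fin (n - 1) := fun i => (Equiv.swap (e j) ⟨β, hαβ.symm⟩ (e i)).1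
  have hτ : Function.Injective τ :=
    Subtype.val_injective.comp ((Equiv.injective _).comp e.injective)
  have hα : ∀ i, τ i ≠ α := fun i => (Equiv.swap (e j) ⟨β, hαβ.symm⟩ (e i)).2
  have hj : τ j = β := by simp [τ]
  refine ⟨τ, Function.update τ j α, hτ, ?_, hα, ?_, hj, by simp, fun i hi => by simp [hi]⟩
  · intro a b hab
    by_cases ha : a = j <;> by_cases hb : b = j
    · rw [ha, hb]
    · simp [ha, hb] at hab
      exact absurd hab.symm (hα b)
    · simp [ha, hb] at hab
      exact absurd hab (hα a)
    · simp [ha, hb] at hab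
      exact hτ hab
  · intro i
    by_cases hi : i = j
    · simp [hi, hαβ]
    · simp only [ne_eq, hi, not_false_eq_true, Function.update_of_ne]
      exact fun h => hi (hτ (h.trans hj.symm))

theorem exists_injective_avoiding (hnr : r + 2 ≤ n) (α : Fin (n - 1)) :
    ∃ τ : Fin r → Fin (n - 1), Function.Injective τ ∧ ∀ i, τ i ≠ α := by
  have hcard : Fintype.card (Fin r) ≤ Fintype.card {c : Fin (n - 1) // c ≠ α} := by
    rw [Fintype.card_subtype_compl, Fintype.card_fin, Fintype.card_fin, Fintype.card_subtype_eq]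
    omega
  obtain ⟨e⟩ := Function.Embedding.nonempty_of_card_le hcard
  exact ⟨fun i => (e i).1, Subtype.val_injective.comp e.injective, fun i => (e i).2⟩

theorem conj_mem_commutator {u : FreeGroup (Fin r)} (hu : u ∈ commutator (FreeGroup (Fin r)))
    (v : FreeGroup (Fin r)) : v * u * v⁻¹ ∈ commutator (FreeGroup (Fin r)) :=
  (inferInstance : (commutator (FreeGroup (Fin r))).Normal).conj_mem u hu v

/-- Conjugation of a diagonal word in the commutator subgroup by a word of a single colour. -/
theorem near_mono_mul_color_of_mem_commutator (hnr : r + 2 ≤ n) {δ : Fin r → Fin (n - 1)}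
    (hδ : Function.Injective δ) (α : Fin (n - 1)) {u : FreeGroup (Fin r)}
    (hu : u ∈ commutator (FreeGroup (Fin r))) (v : FreeGroup (Fin r)) (N : ℕ)
    (hv : v.norm ≤ N) (huN : u.norm ≤ N) :
    Near ((40 * r + 10) * N ^ 2) (mono α v * color δ u) (color δ (v * u * v⁻¹) * mono α v) := by
  obtain ⟨τ, hτ, hα⟩ := exists_injective_avoiding hnr α
  have h1 := (near_color_color hnr hδ hτ hu).mul_left (mono α v)
  have h2 := near_mono_mul_color hτ hα v u N hv huN
  have h3 := (near_color_color hnr hτ hδ (conj_mem_commutator hu v)).mul_right (mono α v)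
  refine ((h1.trans h2).trans h3).mono ?_
  have h4 := norm_conj_le v u
  have b1 : u.norm ^ 2 ≤ N ^ 2 := Nat.pow_le_pow_left huN 2
  have b2 : (v * u * v⁻¹).norm ^ 2 ≤ (3 * N) ^ 2 := Nat.pow_le_pow_left (by omega) 2
  have b3 := Nat.mul_le_mul_left (4 * r) b1
  have b4 := Nat.mul_le_mul_left (4 * r) b2
  refine (Nat.add_le_add (Nat.add_le_add_right b3 _) b4).trans (le_of_eq ?_)
  ring

/-- Forget the colours. -/
def forget : FreeGroup (Letter n r) →* FreeGroup (Fin r) := FreeGroup.lift fun s => of s.2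

@[simp] theorem forget_x (α : Fin (n - 1)) (i : Fin r) : forget (x α i) = of i := by
  simp [forget, x]

theorem forget_comp_color (τ : Fin r → Fin (n - 1)) : forget.comp (color τ) = MonoidHom.id _ := by
  ext i
  simp

@[simp] theorem forget_color (τ : Fin r → Fin (n - 1)) (u : FreeGroup (Fin r)) :
    forget (color τ u) = u :=
  DFunLike.congr_fun (forget_comp_color τ) u

@[simp] theorem forget_mono (α : Fin (n - 1)) (u : FreeGroup (Fin r)) :
    forget (mono α u) = u :=
  forget_color _ u

/-- This identifies the outcome of a chain of rewritings from its invariants, without following the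
words through it. -/
theorem Near.map_eq {G : Type*} [Group G] (f : FreeGroup (Letter n r) →* G)
    (hf : ∀ ρ ∈ relators n r, f ρ = 1) {M : ℕ} {u v : FreeGroup (Letter n r)} (h : Near M u v) :
    f u = f v := by
  obtain ⟨l, h1, h2, -⟩ := h
  suffices f (u⁻¹ * v) = 1 by
    rwa [_root_.map_mul, _root_.map_inv, inv_mul_eq_one] at this
  rw [h2, map_list_prod]
  refine List.prod_eq_one fun y hy => ?_
  simp only [List.map_map, List.mem_map, Function.comp_apply] at hy
  obtain ⟨p, hp, rfl⟩ := hy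
  simp [hf _ (h1 p hp)]

theorem forget_relators (ρ : FreeGroup (Letter n r)) (h : ρ ∈ relators n r) : forget ρ = 1 := by
  rcases h with ⟨i, α, β, hne, rfl⟩ | ⟨i, j, α, β, γ, hij, h1, h2, h3, rfl⟩ <;>
  simp [commutatorElement_def]

/-- Splitting `uv` and `vu` yields the same two partial ratio words in opposite orders, and these
commute at quadratic cost. Only a word coloured by `σ` is left over. -/
theorem Adapted.near_mono_mul_mono_comm {α β : Fin (n - 1)} {τ σ : Fin r → Fin (n - 1)}
    {j : Fin r} (h : Adapted α β τ σ j) (hαβ : α ≠ β) (u v : FreeGroup (Fin r)) (N : ℕ)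
    (hu : u.norm ≤ N) (hv : v.norm ≤ N) :
    Near (428 * N ^ 2) (mono α u * mono β v)
      (mono β v * mono α u * color σ ((v * u)⁻¹ * (u * v))) := by
  have h1 := h.near_mono_mul_mono u v N hu hv
  have h2 := h.symm.near_mono_mul_mono v u N hv hu
  have h3 := h.nearComm_partialRatio hαβ u v
  have hu' := norm_expo_inv_mul_le j u
  have hv' := norm_expo_inv_mul_le j v
  have hue := expo_expo_inv_mul j u
  have hve := expo_expo_inv_mul j v
  generalize (expo j u)⁻¹ * u = u' at *
  generalize (expo j v)⁻¹ * v = v' at *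
  have hQ : (u' * u⁻¹ * v' * u).norm ≤ 6 * N := by
    have h1 := norm_mul_le (u' * u⁻¹ * v') u
    have h2 := norm_mul_le (u' * u⁻¹) v'
    have h3 := norm_mul_le u' u⁻¹
    have h4 : (u⁻¹).norm = u.norm := norm_inv_eq
    omega
  have hQe : expo j (u' * u⁻¹ * v' * u) = 1 := by simp [hue, hve]
  generalize u' * u⁻¹ * v' * u = Q at *
  generalize v' * v⁻¹ * u' * v = P at *
  have h4 := h.near_color hQe
  have h5 := Near.mul_right h3 (color σ P)
  have h6 := (h4.symm.mul_left (partialRatio β σ j v * partialRatio α τ j u)).trans h2.symm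
  have h7 := h6.mul_right (color σ (Q⁻¹ * P))
  rw [mul_assoc _ (color σ Q), ← _root_.map_mul, mul_inv_cancel_left] at h7
  have h8 := (h1.trans h5).trans h7
  -- The leftover word is not simplified by hand: forgetting the colours in `h8` determines it.
  have h9 : Q⁻¹ * P = (v * u)⁻¹ * (u * v) := by
    have := h8.map_eq forget forget_relators
    simp only [_root_.map_mul, forget_mono, forget_color] at this
    rw [eq_inv_mul_iff_mul_eq, ← this]
  rw [h9] at h8
  refine h8.mono ?_
  have b1 : u.norm * v.norm ≤ N * N := Nat.mul_le_mul hu hv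
  have b2 : Q.norm ^ 2 ≤ (6 * N) ^ 2 := Nat.pow_le_pow_left hQ 2
  nlinarith

/-- Words in two different colours commute up to a diagonal word in the commutator subgroup. -/
theorem near_swap (hr : 0 < r) (hnr : r + 2 ≤ n) {δ : Fin r → Fin (n - 1)}
    (hδ : Function.Injective δ) : ∃ C : ℕ, ∀ (α β : Fin (n - 1)), α ≠ β →
    ∀ (u v : FreeGroup (Fin r)) (N : ℕ), u.norm ≤ N → v.norm ≤ N →
    Near (C * N ^ 2) (mono α u * mono β v) (color δ ⁅u, v⁆ * mono β v * mono α u) := by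
  refine ⟨428 + 4 * r * 16 + (40 * r + 10) * 36 + (40 * r + 10) * 16,
    fun α β hαβ u v N hu hv => ?_⟩
  -- Any letter can play the exceptional role.
  obtain ⟨τ, σ, h⟩ := exists_adapted hnr hαβ ⟨0, hr⟩
  have h1 := h.near_mono_mul_mono_comm hαβ u v N hu hv
  have e : (v * u)⁻¹ * (u * v) = ⁅u⁻¹, v⁻¹⁆ := by
    rw [commutatorElement_def]
    group
  rw [e] at h1
  have hE : ⁅u⁻¹, v⁻¹⁆ ∈ commutator (FreeGroup (Fin r)) :=
    Subgroup.commutator_mem_commutator (Subgroup.mem_top _) (Subgroup.mem_top _)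
  have hn : ⁅u⁻¹, v⁻¹⁆.norm ≤ 4 * N := by
    have h1 := norm_mul_le (v * u)⁻¹ (u * v)
    have h2 := norm_mul_le u v
    have h3 := norm_mul_le v u
    have h4 : ((v * u)⁻¹).norm = (v * u).norm := norm_inv_eq
    rw [e] at h1
    omega
  have hn2 := norm_conj_le u ⁅u⁻¹, v⁻¹⁆
  have h2 := (near_color_color hnr h.injective_right hδ hE).mul_left (mono β v * mono α u)
  have h3 := (near_mono_mul_color_of_mem_commutator hnr hδ α hE u (4 * N) (by omega)
    hn).mul_left (mono β v)
  have h4 := (near_mono_mul_color_of_mem_commutator hnr hδ β (conj_mem_commutator hE u) v (6 * N)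
    (by omega) (by omega)).mul_right (mono α u)
  have e2 : v * (u * ⁅u⁻¹, v⁻¹⁆ * u⁻¹) * v⁻¹ = ⁅u, v⁆ := by
    rw [commutatorElement_def, commutatorElement_def]
    group
  rw [e2] at h4
  generalize ⁅u⁻¹, v⁻¹⁆ = E at *
  simp only [mul_assoc] at h1 h2 h3 h4 ⊢
  refine (((h1.trans h2).trans h3).trans h4).mono ?_
  have b1 : E.norm ^ 2 ≤ (4 * N) ^ 2 := Nat.pow_le_pow_left hn 2
  have b2 := Nat.mul_le_mul_left (4 * r) b1
  simp only [mul_assoc] at b2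
  refine (Nat.add_le_add_right (Nat.add_le_add_right (Nat.add_le_add_left b2 _) _) _).trans
    (le_of_eq ?_)
  ring

/-! ### Moving words past blocks -/

/-- The product of the words `q α` in the colours `α`, in the order of the list `L`. -/
def blocks (L : List (Fin (n - 1))) (q : Fin (n - 1) → FreeGroup (Fin r)) :
    FreeGroup (Letter n r) :=
  (L.map fun α => mono α (q α)).prod

@[simp] theorem blocks_nil (q : Fin (n - 1) → FreeGroup (Fin r)) :
    blocks ([] : List (Fin (n - 1))) q = 1 := rfl

@[simp] theorem blocks_cons (α : Fin (n - 1)) (L : List (Fin (n - 1)))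
    (q : Fin (n - 1) → FreeGroup (Fin r)) : blocks (α :: L) q = mono α (q α) * blocks L q := by
  simp [blocks]

@[simp] theorem blocks_append (L L' : List (Fin (n - 1)))
    (q : Fin (n - 1) → FreeGroup (Fin r)) : blocks (L ++ L') q = blocks L q * blocks L' q := by
  simp [blocks]

theorem blocks_congr {L : List (Fin (n - 1))} {q q' : Fin (n - 1) → FreeGroup (Fin r)}
    (h : ∀ α ∈ L, q α = q' α) : blocks L q = blocks L q' := by
  unfold blocks
  congr 1
  exact List.map_congr_left fun α hα => by rw [h α hα]

theorem norm_prod_map_le {ι : Type*} (L : List ι) (q : ι → FreeGroup (Fin r)) (N : ℕ)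
    (hq : ∀ α, (q α).norm ≤ N) : (L.map q).prod.norm ≤ L.length * N := by
  induction L with
  | nil => simp
  | cons a L ih =>
    have h1 := norm_mul_le (q a) (L.map q).prod
    have h2 := hq a
    simp only [List.map_cons, List.prod_cons, List.length_cons]
    rw [Nat.succ_mul]
    omega

theorem norm_commutatorElement_le (u v : FreeGroup (Fin r)) :
    ⁅u, v⁆.norm ≤ 2 * u.norm + 2 * v.norm := by
  have h1 := norm_mul_le (u * v * u⁻¹) v⁻¹
  have h2 := norm_conj_le u v
  have h3 : (v⁻¹).norm = v.norm := norm_inv_eq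
  rw [commutatorElement_def]
  omega

/-- The blocks are passed one at a time, each conjugating the coloured word; its length stays below
(2k + 1)N. -/
theorem near_blocks_mul_color (hnr : r + 2 ≤ n) {δ : Fin r → Fin (n - 1)}
    (hδ : Function.Injective δ) (k : ℕ) : ∃ C : ℕ, ∀ L : List (Fin (n - 1)), L.length ≤ k →
    ∀ (q : Fin (n - 1) → FreeGroup (Fin r)) (e : FreeGroup (Fin r)) (N : ℕ),
    e ∈ commutator (FreeGroup (Fin r)) → (∀ α, (q α).norm ≤ N) → e.norm ≤ N →
    Near (C * N ^ 2) (blocks L q * color δ e)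
      (color δ ((L.map q).prod * e * (L.map q).prod⁻¹) * blocks L q) := by
  induction k with
  | zero =>
    refine ⟨0, fun L hL q e N _ _ _ => ?_⟩
    rw [List.length_eq_zero_iff.1 (Nat.le_zero.1 hL)]
    exact (Near.of_eq (by simp)).mono (Nat.zero_le _)
  | succ k ih =>
    obtain ⟨C, hC⟩ := ih
    refine ⟨C + (40 * r + 10) * (2 * k + 1) ^ 2, fun L hL q e N he hq heN => ?_⟩
    rcases L with _ | ⟨a, L⟩
    · exact (Near.of_eq (by simp)).mono (Nat.zero_le _)
    simp only [List.length_cons, Nat.add_le_add_iff_right] at hL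
    have h1 := (hC L hL q e N he hq heN).mul_left (mono a (q a))
    have hT := norm_prod_map_le L q N hq
    have hT2 : L.length * N ≤ k * N := Nat.mul_le_mul_right N hL
    have hn := norm_conj_le (L.map q).prod e
    have hqa := hq a
    have h2 := (near_mono_mul_color_of_mem_commutator hnr hδ a
      (conj_mem_commutator he (L.map q).prod) (q a) ((2 * k + 1) * N) (by nlinarith)
      (by nlinarith)).mul_right (blocks L q)
    have e1 : q a * ((L.map q).prod * e * (L.map q).prod⁻¹) * (q a)⁻¹ =
        ((a :: L).map q).prod * e * ((a :: L).map q).prod⁻¹ := by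
      simp only [List.map_cons, List.prod_cons]
      group
    rw [e1] at h2
    simp only [blocks_cons]
    rw [← mul_assoc] at h1
    rw [mul_assoc (mono a (q a))] at h2 ⊢
    rw [mul_assoc (mono a (q a))] at h1
    rw [mul_assoc _ _ (blocks L q)] at h2
    refine (h1.trans ((Near.of_eq (by simp only [mul_assoc])).trans h2)).mono (le_of_eq ?_)
    ring

/-- Each exchange creates a commutator, and [ab, u] = a[b, u]a⁻¹ · [a, u] collects them all into
one. -/
theorem near_blocks_mul_mono (hr : 0 < r) (hnr : r + 2 ≤ n) {δ : Fin r → Fin (n - 1)}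
    (hδ : Function.Injective δ) (k : ℕ) : ∃ C : ℕ, ∀ L : List (Fin (n - 1)), L.length ≤ k →
    ∀ (β : Fin (n - 1)) (q : Fin (n - 1) → FreeGroup (Fin r)) (u : FreeGroup (Fin r)) (N : ℕ),
    β ∉ L → (∀ α, (q α).norm ≤ N) → u.norm ≤ N →
    Near (C * N ^ 2) (blocks L q * mono β u)
      (color δ ⁅(L.map q).prod, u⁆ * mono β u * blocks L q) := by
  induction k with
  | zero =>
    refine ⟨0, fun L hL β q u N _ _ _ => ?_⟩
    rw [List.length_eq_zero_iff.1 (Nat.le_zero.1 hL)]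
    exact (Near.of_eq (by simp)).mono (Nat.zero_le _)
  | succ k ih =>
    obtain ⟨C, hC⟩ := ih
    obtain ⟨C', hC'⟩ := near_swap hr hnr hδ
    refine ⟨C + (40 * r + 10) * (2 * k + 2) ^ 2 + C', fun L hL β q u N hβ hq huN => ?_⟩
    rcases L with _ | ⟨a, L⟩
    · exact (Near.of_eq (by simp)).mono (Nat.zero_le _)
    simp only [List.length_cons, Nat.add_le_add_iff_right] at hL
    rw [List.mem_cons, not_or] at hβ
    have h1 := (hC L hL β q u N hβ.2 hq huN).mul_left (mono a (q a))
    have hT := norm_prod_map_le L q N hq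
    have hT2 : L.length * N ≤ k * N := Nat.mul_le_mul_right N hL
    have hn := norm_commutatorElement_le (L.map q).prod u
    have hqa := hq a
    have hE : ⁅(L.map q).prod, u⁆ ∈ commutator (FreeGroup (Fin r)) :=
      Subgroup.commutator_mem_commutator (Subgroup.mem_top _) (Subgroup.mem_top _)
    have h2 := (near_mono_mul_color_of_mem_commutator hnr hδ a
      hE (q a) ((2 * k + 2) * N) (by nlinarith) (by nlinarith)).mul_right
      (mono β u * blocks L q)
    have h3 := ((hC' a β (Ne.symm hβ.1) (q a) u N hqa huN).mul_right (blocks L q)).mul_left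
      (color δ (q a * ⁅(L.map q).prod, u⁆ * (q a)⁻¹))
    have e1 : ⁅((a :: L).map q).prod, u⁆ =
        q a * ⁅(L.map q).prod, u⁆ * (q a)⁻¹ * ⁅q a, u⁆ := by
      simp only [List.map_cons, List.prod_cons, commutatorElement_def]
      group
    rw [e1, _root_.map_mul]
    generalize q a * ⁅(L.map q).prod, u⁆ * (q a)⁻¹ = E at *
    simp only [blocks_cons, mul_assoc] at h1 h2 h3 ⊢
    refine ((h1.trans h2).trans h3).mono (le_of_eq ?_)
    ring

/-! ### Invariants of words and the normal form they determine -/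

/-- Retraction onto the words in the colour `α`. -/
def retr (α : Fin (n - 1)) : FreeGroup (Letter n r) →* FreeGroup (Fin r) :=
  FreeGroup.lift fun s => if s.1 = α then of s.2 else 1

@[simp] theorem retr_x (α β : Fin (n - 1)) (i : Fin r) :
    retr α (x β i) = if β = α then of i else 1 := by
  simp [retr, x]

theorem norm_retr_le (α : Fin (n - 1)) (w : FreeGroup (Letter n r)) :
    (retr α w).norm ≤ w.norm := by
  refine norm_hom_le _ (fun s => ?_) w
  by_cases h : s.1 = α <;> simp [retr, h, norm_of]

theorem norm_forget_le (w : FreeGroup (Letter n r)) : (forget w).norm ≤ w.norm :=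
  norm_hom_le _ (fun s => by simp [forget, norm_of]) w

theorem norm_color_le (τ : Fin r → Fin (n - 1)) (u : FreeGroup (Fin r)) :
    (color τ u).norm ≤ u.norm :=
  norm_hom_le _ (fun s => by simp [x, norm_of]) u

theorem norm_mono_le (α : Fin (n - 1)) (u : FreeGroup (Fin r)) : (mono α u).norm ≤ u.norm :=
  norm_color_le _ u

theorem retr_mono_self (α : Fin (n - 1)) (u : FreeGroup (Fin r)) : retr α (mono α u) = u := by
  have : (retr α).comp (mono α) = MonoidHom.id (FreeGroup (Fin r)) := by
    ext i
    simp
  exact DFunLike.congr_fun this u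

theorem retr_mono_of_ne {α β : Fin (n - 1)} (h : β ≠ α) (u : FreeGroup (Fin r)) :
    retr α (mono β u) = 1 := by
  have : (retr α).comp (mono β) = (1 : FreeGroup (Fin r) →* FreeGroup (Fin r)) := by
    ext i
    simp [h]
  exact DFunLike.congr_fun this u

theorem retr_blocks_of_notMem {α : Fin (n - 1)} {L : List (Fin (n - 1))} (h : α ∉ L)
    (q : Fin (n - 1) → FreeGroup (Fin r)) : retr α (blocks L q) = 1 := by
  rw [blocks, map_list_prod]
  refine List.prod_eq_one fun y hy => ?_
  simp only [List.map_map, List.mem_map, Function.comp_apply] at hy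
  obtain ⟨β, hβ, rfl⟩ := hy
  exact retr_mono_of_ne (fun hβα => h (by rwa [← hβα])) _

theorem retr_blocks_finRange (α : Fin (n - 1)) (q : Fin (n - 1) → FreeGroup (Fin r)) :
    retr α (blocks (List.finRange (n - 1)) q) = q α := by
  obtain ⟨s, t, hst⟩ := List.append_of_mem (List.mem_finRange α)
  have hnd := List.nodup_finRange (n - 1)
  rw [hst, List.nodup_middle, List.nodup_cons, List.mem_append, not_or] at hnd
  rw [hst, blocks_append, blocks_cons, _root_.map_mul, _root_.map_mul,
    retr_blocks_of_notMem hnd.1.1, retr_blocks_of_notMem hnd.1.2, retr_mono_self, one_mul, mul_one]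

theorem forget_blocks (L : List (Fin (n - 1))) (q : Fin (n - 1) → FreeGroup (Fin r)) :
    forget (blocks L q) = (L.map q).prod := by
  rw [blocks, map_list_prod, List.map_map]
  congr 1
  exact List.map_congr_left fun α _ => by simp

/-- An injective colouring uses the colour `α` for at most one letter, so the retraction sees only
one exponent sum, which vanishes on commutators. -/
theorem retr_color_of_mem_commutator (α : Fin (n - 1)) {δ : Fin r → Fin (n - 1)}
    (hδ : Function.Injective δ) {d : FreeGroup (Fin r)}
    (hd : d ∈ commutator (FreeGroup (Fin r))) : retr α (color δ d) = 1 := by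
  by_cases h : ∃ j, δ j = α
  · obtain ⟨j, rfl⟩ := h
    have : (retr (δ j)).comp (color δ) = expo j := by
      ext i
      by_cases hi : i = j
      · simp [hi]
      · simp [hi, hδ.eq_iff]
    rw [← expo_of_mem_commutator j hd, ← this]
    rfl
  · have : (retr α).comp (color δ) = (1 : FreeGroup (Fin r) →* FreeGroup (Fin r)) := by
      ext i
      have hi : δ i ≠ α := fun hi => h ⟨i, hi⟩
      simp [hi]
    exact DFunLike.congr_fun this d

/-- The part of `w` in the last factor that is not accounted for by the single-coloured blocks. -/
def defect (w : FreeGroup (Letter n r)) : FreeGroup (Fin r) :=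
  forget w * ((List.finRange (n - 1)).map fun α => retr α w).prod⁻¹

/-- Every letter has exactly one colour, so in the abelianization `forget` is the product of the
retractions. -/
theorem defect_mem_commutator (w : FreeGroup (Letter n r)) :
    defect w ∈ commutator (FreeGroup (Fin r)) := by
  have h : (Abelianization.of.comp forget : FreeGroup (Letter n r) →* _) =
      ∏ α, Abelianization.of.comp (retr α) := by
    ext s
    simp only [MonoidHom.comp_apply, MonoidHom.finsetProd_apply]
    rw [Finset.prod_eq_single s.1]
    · simp [forget, retr]
    · intro β _ hβ
      simp [retr, hβ.symm]
    · simp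
  have h2 := DFunLike.congr_fun h w
  rw [MonoidHom.finsetProd_apply, Fin.prod_univ_def] at h2
  simp only [MonoidHom.comp_apply] at h2
  rw [← Abelianization.ker_of, MonoidHom.mem_ker, defect, _root_.map_mul, _root_.map_inv,
    map_list_prod, List.map_map, h2]
  exact mul_inv_cancel _

theorem norm_defect_le (w : FreeGroup (Letter n r)) : (defect w).norm ≤ n * w.norm := by
  have h1 := norm_mul_le (forget w) ((List.finRange (n - 1)).map fun α => retr α w).prod⁻¹
  have h2 : (((List.finRange (n - 1)).map fun α => retr α w).prod⁻¹).norm =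
    ((List.finRange (n - 1)).map fun α => retr α w).prod.norm := norm_inv_eq
  have h3 := norm_prod_map_le (List.finRange (n - 1)) (fun α => retr α w) w.norm
    fun α => norm_retr_le α w
  have h4 := norm_forget_le w
  rw [List.length_finRange] at h3
  rw [defect]
  rcases n with _ | n
  · have : w = 1 := by
      have : IsEmpty (Letter 0 r) := ⟨fun s => Nat.not_lt_zero _ s.1.2⟩
      exact Subsingleton.elim _ _
    subst this
    simp
  · rw [Nat.succ_mul]
    simp only [Nat.add_sub_cancel] at h1 h2 h3 ⊢
    omega

/-- The word in normal form with the same value as `w`. -/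
def normalForm (δ : Fin r → Fin (n - 1)) (w : FreeGroup (Letter n r)) : FreeGroup (Letter n r) :=
  color δ (defect w) * blocks (List.finRange (n - 1)) fun α => retr α w

theorem normalForm_congr (δ : Fin r → Fin (n - 1)) {w w' : FreeGroup (Letter n r)}
    (h : ∀ α, retr α w = retr α w') (h' : forget w = forget w') :
    normalForm δ w = normalForm δ w' := by
  simp only [normalForm, defect, h, h']

theorem retr_color_mul_blocks {δ : Fin r → Fin (n - 1)} (hδ : Function.Injective δ)
    {d : FreeGroup (Fin r)} (hd : d ∈ commutator (FreeGroup (Fin r)))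
    (q : Fin (n - 1) → FreeGroup (Fin r)) (α : Fin (n - 1)) :
    retr α (color δ d * blocks (List.finRange (n - 1)) q) = q α := by
  rw [_root_.map_mul, retr_color_of_mem_commutator α hδ hd, retr_blocks_finRange, one_mul]

theorem normalForm_color_mul_blocks {δ : Fin r → Fin (n - 1)} (hδ : Function.Injective δ)
    {d : FreeGroup (Fin r)} (hd : d ∈ commutator (FreeGroup (Fin r)))
    (q : Fin (n - 1) → FreeGroup (Fin r)) :
    normalForm δ (color δ d * blocks (List.finRange (n - 1)) q) =
      color δ d * blocks (List.finRange (n - 1)) q := by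
  simp only [normalForm, defect, retr_color_mul_blocks hδ hd, _root_.map_mul, forget_color,
    forget_blocks, mul_inv_cancel_right]

theorem retr_normalForm {δ : Fin r → Fin (n - 1)} (hδ : Function.Injective δ)
    (w : FreeGroup (Letter n r)) (α : Fin (n - 1)) : retr α (normalForm δ w) = retr α w :=
  retr_color_mul_blocks hδ (defect_mem_commutator w) _ α

theorem forget_normalForm (δ : Fin r → Fin (n - 1)) (w : FreeGroup (Letter n r)) :
    forget (normalForm δ w) = forget w := by
  rw [normalForm, _root_.map_mul, forget_color, forget_blocks, defect, inv_mul_cancel_right]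

theorem normalForm_normalForm_mul {δ : Fin r → Fin (n - 1)} (hδ : Function.Injective δ)
    (w w' : FreeGroup (Letter n r)) : normalForm δ (normalForm δ w * w') = normalForm δ (w * w') :=
  normalForm_congr δ (fun α => by simp [retr_normalForm hδ]) (by simp [forget_normalForm])

theorem retr_relators (κ : Fin (n - 1)) (ρ : FreeGroup (Letter n r)) (h : ρ ∈ relators n r) :
    retr κ ρ = 1 := by
  rcases h with ⟨i, α, β, hne, rfl⟩ | ⟨i, j, α, β, γ, hij, h1, h2, h3, rfl⟩
  · by_cases hα : α = κ
    · simp [commutatorElement_def, hα]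
    · simp [commutatorElement_def, hα]
  · by_cases hα : α = κ
    · subst hα
      simp [commutatorElement_def, h1.symm, h2.symm]
    · rw [map_commutatorElement, retr_x, if_neg hα, commutatorElement_one_left]

theorem Near.normalForm_eq (δ : Fin r → Fin (n - 1)) {M : ℕ} {w w' : FreeGroup (Letter n r)}
    (h : Near M w w') : normalForm δ w = normalForm δ w' :=
  normalForm_congr δ (fun α => h.map_eq _ (retr_relators α)) (h.map_eq _ forget_relators)

/-! ### Normalisation at quadratic cost -/

/-- If the product of a normal form with `v` can be brought into the shape of a normal form, then
this is the normal form of the product. -/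
theorem near_normalForm_mul {δ : Fin r → Fin (n - 1)} (hδ : Function.Injective δ) {M : ℕ}
    {w v : FreeGroup (Letter n r)} {d : FreeGroup (Fin r)}
    (hd : d ∈ commutator (FreeGroup (Fin r))) {q : Fin (n - 1) → FreeGroup (Fin r)}
    (h : Near M (normalForm δ w * v) (color δ d * blocks (List.finRange (n - 1)) q)) :
    Near M (normalForm δ w * v) (normalForm δ (w * v)) := by
  rw [← normalForm_normalForm_mul hδ, h.normalForm_eq δ, normalForm_color_mul_blocks hδ hd]
  exact h

theorem near_normalForm_mul_color (hnr : r + 2 ≤ n) {δ : Fin r → Fin (n - 1)}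
    (hδ : Function.Injective δ) : ∃ C : ℕ, ∀ (w : FreeGroup (Letter n r))
    (e : FreeGroup (Fin r)) (N : ℕ), e ∈ commutator (FreeGroup (Fin r)) → w.norm ≤ N →
    e.norm ≤ N → Near (C * N ^ 2) (normalForm δ w * color δ e) (normalForm δ (w * color δ e)) := by
  obtain ⟨C, hC⟩ := near_blocks_mul_color hnr hδ (n - 1)
  refine ⟨C, fun w e N he hw heN => ?_⟩
  have h1 := (hC (List.finRange (n - 1)) (by simp) (fun α => retr α w) e N he
    (fun α => (norm_retr_le α w).trans hw) heN).mul_left (color δ (defect w))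
  refine near_normalForm_mul hδ (mul_mem (defect_mem_commutator w)
    (conj_mem_commutator he ((List.finRange (n - 1)).map fun α => retr α w).prod))
    (q := fun α => retr α w) ?_
  rw [_root_.map_mul]
  simpa only [normalForm, mul_assoc] using h1

/-- The new word moves left past the blocks after `β` and merges with the block of `β`. The
commutator thereby created, of length at most 2nN, travels on to the diagonal part. -/
theorem near_normalForm_mul_mono (hr : 0 < r) (hnr : r + 2 ≤ n) {δ : Fin r → Fin (n - 1)}
    (hδ : Function.Injective δ) : ∃ C : ℕ, ∀ (w : FreeGroup (Letter n r)) (β : Fin (n - 1))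
    (u : FreeGroup (Fin r)) (N : ℕ), w.norm ≤ N → u.norm ≤ N →
    Near (C * N ^ 2) (normalForm δ w * mono β u) (normalForm δ (w * mono β u)) := by
  obtain ⟨C, hC⟩ := near_blocks_mul_color hnr hδ (n - 1)
  obtain ⟨C', hC'⟩ := near_blocks_mul_mono hr hnr hδ (n - 1)
  refine ⟨C' + C * (2 * n) ^ 2, fun w β u N hw huN => ?_⟩
  have hlen : (List.finRange (n - 1)).length = n - 1 := by simp
  obtain ⟨s, t, hst⟩ := List.append_of_mem (List.mem_finRange β)
  have hnd := List.nodup_finRange (n - 1)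
  rw [hst, List.nodup_middle, List.nodup_cons, List.mem_append, not_or] at hnd
  rw [hst] at hlen
  simp only [List.length_append, List.length_cons] at hlen
  have hq : ∀ α, (retr α w).norm ≤ N := fun α => (norm_retr_le α w).trans hw
  have h1 := hC' t (by omega) β (fun α => retr α w) u N hnd.1.2 hq huN
  have hT := norm_prod_map_le t (fun α => retr α w) N hq
  have hn := norm_commutatorElement_le (t.map fun α => retr α w).prod u
  have hE : ⁅(t.map fun α => retr α w).prod, u⁆ ∈ commutator (FreeGroup (Fin r)) :=
    Subgroup.commutator_mem_commutator (Subgroup.mem_top _) (Subgroup.mem_top _)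
  have hnt : (t.length + 1) * N ≤ n * N := Nat.mul_le_mul_right N (by omega)
  have h2 := hC (s ++ [β]) (by simp; omega) (fun α => retr α w) _ (2 * n * N) hE
    (fun α => (hq α).trans (by nlinarith)) (by nlinarith)
  have h1' := h1.mul_left (color δ (defect w) * blocks (s ++ [β]) fun α => retr α w)
  have h2' := (h2.mul_left (color δ (defect w))).mul_right
    (mono β u * blocks t fun α => retr α w)
  generalize ⁅(t.map fun α => retr α w).prod, u⁆ = E at *
  refine near_normalForm_mul hδ (mul_mem (defect_mem_commutator w)
    (conj_mem_commutator hE ((s ++ [β]).map fun α => retr α w).prod))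
    (q := Function.update (fun α => retr α w) β (retr β w * u)) ?_
  have e1 : blocks s (Function.update (fun α => retr α w) β (retr β w * u)) =
      blocks s fun α => retr α w :=
    blocks_congr fun α hα => Function.update_of_ne (by rintro rfl; exact hnd.1.1 hα) _ _
  have e2 : blocks t (Function.update (fun α => retr α w) β (retr β w * u)) =
      blocks t fun α => retr α w :=
    blocks_congr fun α hα => Function.update_of_ne (by rintro rfl; exact hnd.1.2 hα) _ _
  rw [normalForm, hst, _root_.map_mul (color δ) (defect w), blocks_append, blocks_append, blocks_cons,
    blocks_cons, e1, e2, Function.update_self, _root_.map_mul (mono β)]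
  simp only [blocks_append, blocks_cons, blocks_nil, mul_one, mul_assoc] at h1' h2' ⊢
  refine (h1'.trans h2').mono (le_of_eq ?_)
  ring

theorem near_normalForm_mul_blocks (hr : 0 < r) (hnr : r + 2 ≤ n) {δ : Fin r → Fin (n - 1)}
    (hδ : Function.Injective δ) (L : List (Fin (n - 1))) : ∃ C : ℕ,
    ∀ (w : FreeGroup (Letter n r)) (q : Fin (n - 1) → FreeGroup (Fin r)) (N : ℕ), w.norm ≤ N →
    (∀ α, (q α).norm ≤ N) →
    Near (C * N ^ 2) (normalForm δ w * blocks L q) (normalForm δ (w * blocks L q)) := by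
  induction L with
  | nil => exact ⟨0, fun w q N _ _ => (Near.of_eq (by simp)).mono (Nat.zero_le _)⟩
  | cons a L ih =>
    obtain ⟨C, hC⟩ := ih
    obtain ⟨C', hC'⟩ := near_normalForm_mul_mono hr hnr hδ
    refine ⟨C' + C * 4, fun w q N hw hq => ?_⟩
    have h1 := (hC' w a (q a) N hw (hq a)).mul_right (blocks L q)
    have h3 := norm_mul_le w (mono a (q a))
    have h4 := norm_mono_le a (q a)
    have h5 := hq a
    have h2 := hC (w * mono a (q a)) q (2 * N) (by omega) fun α => (hq α).trans (by omega)
    simp only [blocks_cons, mul_assoc] at h1 h2 ⊢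
    refine (h1.trans h2).mono (le_of_eq ?_)
    ring

theorem near_normalForm_mul_normalForm (hr : 0 < r) (hnr : r + 2 ≤ n) {δ : Fin r → Fin (n - 1)}
    (hδ : Function.Injective δ) : ∃ C : ℕ, ∀ (w w' : FreeGroup (Letter n r)) (N : ℕ),
    w.norm ≤ N → w'.norm ≤ N →
    Near (C * N ^ 2) (normalForm δ w * normalForm δ w') (normalForm δ (w * w')) := by
  obtain ⟨C, hC⟩ := near_normalForm_mul_color hnr hδ
  obtain ⟨C', hC'⟩ := near_normalForm_mul_blocks hr hnr hδ (List.finRange (n - 1))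
  refine ⟨C * n ^ 2 + C' * (n + 1) ^ 2, fun w w' N hw hw' => ?_⟩
  have hd : (defect w').norm ≤ n * N := (norm_defect_le w').trans (Nat.mul_le_mul_left n hw')
  have h1 := (hC w (defect w') (n * N) (defect_mem_commutator w') (by nlinarith) hd).mul_right
    (blocks (List.finRange (n - 1)) fun α => retr α w')
  have h3 := norm_mul_le w (color δ (defect w'))
  have h4 := norm_color_le δ (defect w')
  have h2 := hC' (w * color δ (defect w')) (fun α => retr α w') ((n + 1) * N) (by nlinarith)
    fun α => ((norm_retr_le α w').trans hw').trans (by nlinarith)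
  have e : normalForm δ (w * normalForm δ w') = normalForm δ (w * w') :=
    normalForm_congr δ (fun α => by simp [retr_normalForm hδ]) (by simp [forget_normalForm])
  rw [← e]
  simp only [normalForm, mul_assoc] at h1 h2 ⊢
  refine (h1.trans h2).mono (le_of_eq ?_)
  ring

theorem normalForm_one (δ : Fin r → Fin (n - 1)) :
    normalForm δ (1 : FreeGroup (Letter n r)) = 1 := by
  simp only [normalForm, defect, blocks, _root_.map_one, one_mul]
  rw [List.prod_eq_one (by simp), List.prod_eq_one (by simp)]
  simp

theorem normalForm_mono {δ : Fin r → Fin (n - 1)} (hδ : Function.Injective δ) (α : Fin (n - 1))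
    (u : FreeGroup (Fin r)) : normalForm δ (mono α u) = mono α u := by
  have h : color δ 1 * blocks (List.finRange (n - 1)) (Function.update (fun _ => 1) α u) =
      mono α u := by
    obtain ⟨s, t, hst⟩ := List.append_of_mem (List.mem_finRange α)
    have hnd := List.nodup_finRange (n - 1)
    rw [hst, List.nodup_middle, List.nodup_cons, List.mem_append, not_or] at hnd
    have key : ∀ L : List (Fin (n - 1)), α ∉ L →
        blocks L (Function.update (fun _ => (1 : FreeGroup (Fin r))) α u) = 1 := by
      intro L hL
      rw [blocks_congr (q' := fun _ => 1) fun β hβ => Function.update_of_ne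
        (by rintro rfl; exact hL hβ) _ _]
      exact List.prod_eq_one (by simp)
    rw [hst, blocks_append, blocks_cons, key s hnd.1.1, key t hnd.1.2]
    simp
  rw [← h]
  exact normalForm_color_mul_blocks hδ (one_mem _) _

/-- Every word can be brought into normal form at quadratic cost. -/
theorem near_normalForm (hr : 0 < r) (hnr : r + 2 ≤ n) {δ : Fin r → Fin (n - 1)}
    (hδ : Function.Injective δ) : ∃ C : ℕ, ∀ w : FreeGroup (Letter n r),
    Near (C * w.norm ^ 2) w (normalForm δ w) := by
  obtain ⟨C, hC⟩ := near_normalForm_mul_normalForm hr hnr hδ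
  -- Halving needs a(⌊k/2⌋² + ⌈k/2⌉²) + k² ≤ ak². For even k the value a = 2 would do; odd k require
  -- slightly more.
  refine ⟨3 * C, fun w => ?_⟩
  suffices h : ∀ k : ℕ, ∀ w : FreeGroup (Letter n r), w.norm ≤ k →
      Near (3 * C * k ^ 2) w (normalForm δ w) from h _ w le_rfl
  intro k
  induction k using Nat.strong_induction_on with
  | _ k ih =>
    intro w hw
    rcases Nat.lt_or_ge k 2 with hk | hk
    · refine (Near.of_eq ?_).mono (Nat.zero_le _)
      rcases Nat.eq_zero_or_pos w.norm with h0 | h0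
      · rw [norm_eq_zero.1 h0, normalForm_one]
      · have h1 : w.toWord.length = 1 := by
          have : w.toWord.length = w.norm := rfl
          omega
        obtain ⟨⟨⟨α, i⟩, b⟩, hs⟩ := List.length_eq_one_iff.1 h1
        have h2 : w = mk [((α, i), b)] := by rw [← hs, mk_toWord]
        cases b with
        | true =>
          have : w = mono α (of i) := by
            rw [h2, mono_of]
            rfl
          rw [this, normalForm_mono hδ]
        | false =>
          have : w = mono α (of i)⁻¹ := by
            rw [h2, _root_.map_inv, mono_of]
            simp [x, of, inv_mk, invRev]
          rw [this, normalForm_mono hδ]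
    · obtain ⟨u, v, rfl, hu, hv⟩ := exists_mul_eq_of_norm w (k / 2)
      have hv' : v.norm ≤ k - k / 2 := by omega
      have h1 := (ih (k / 2) (by omega) u hu).mul (ih (k - k / 2) (by omega) v hv')
      have h2 := hC u v k (by omega) (by omega)
      refine (h1.trans h2).mono ?_
      obtain ⟨j, hj | hj⟩ := Nat.even_or_odd' k
      · have e1 : k / 2 = j := by omega
        have e2 : k - k / 2 = j := by omega
        rw [e2, e1, hj]
        nlinarith [Nat.zero_le (C * j ^ 2)]
      · have e1 : k / 2 = j := by omega
        have e2 : k - k / 2 = j + 1 := by omega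
        have hj1 : 1 ≤ j := by omega
        rw [e2, e1, hj]
        have h3 : 3 * (j ^ 2 + (j + 1) ^ 2) + (2 * j + 1) ^ 2 ≤ 3 * (2 * j + 1) ^ 2 := by nlinarith
        have := Nat.mul_le_mul_left C h3
        nlinarith

/-! ### Evaluation in `K` -/

/-- The automorphism of the free group that inverts the letters. -/
def bar : FreeGroup (Fin r) →* FreeGroup (Fin r) := FreeGroup.lift fun i => (of i)⁻¹

theorem bar_bar (u : FreeGroup (Fin r)) : bar (bar u) = u := by
  have : (bar : FreeGroup (Fin r) →* FreeGroup (Fin r)).comp bar = MonoidHom.id _ := by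
    ext i
    simp [bar]
  exact DFunLike.congr_fun this u

theorem eval_apply_of_lt (w : FreeGroup (Letter n r)) (α : Fin (n - 1)) (h : (α : ℕ) < n) :
    (eval n r w : Ambient n r) ⟨α, h⟩ = retr α w := by
  have : ((Pi.evalMonoidHom (fun _ : Fin n => FreeGroup (Fin r)) ⟨α, h⟩).comp
      (K n r).subtype).comp (eval n r) = retr α := by
    ext s
    obtain ⟨β, i⟩ := s
    have h1 : (⟨α, h⟩ : Fin n) ≠ ⟨n - 1, by omega⟩ := by
      intro he
      have := congrArg Fin.val he
      have := α.2
      simp at *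
      omega
    by_cases hβ : β = α
    · subst hβ
      simp [eval, gen, basisElt, retr, Pi.mulSingle_eq_of_ne h1]
    · have h2 : (⟨α, h⟩ : Fin n) ≠ ⟨β, by omega⟩ := by
        intro he
        have := congrArg Fin.val he
        exact hβ (Fin.ext this.symm)
      simp [eval, gen, basisElt, retr, hβ, Pi.mulSingle_eq_of_ne h1, Pi.mulSingle_eq_of_ne h2]
  exact DFunLike.congr_fun this w

theorem eval_apply_last (w : FreeGroup (Letter n r)) (h : n - 1 < n) :
    (eval n r w : Ambient n r) ⟨n - 1, h⟩ = bar (forget w) := by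
  have : ((Pi.evalMonoidHom (fun _ : Fin n => FreeGroup (Fin r)) ⟨n - 1, h⟩).comp
      (K n r).subtype).comp (eval n r) = bar.comp forget := by
    ext s
    obtain ⟨β, i⟩ := s
    have h1 : (⟨n - 1, h⟩ : Fin n) ≠ ⟨β, by omega⟩ := by
      intro he
      have := congrArg Fin.val he
      have := β.2
      simp at *
      omega
    simp [eval, gen, basisElt, forget, bar, Pi.mulSingle_eq_of_ne h1]
  exact DFunLike.congr_fun this w

theorem eval_eq_iff (hn : 0 < n) (w : FreeGroup (Letter n r)) (g : K n r) :
    eval n r w = g ↔ (∀ (α : Fin (n - 1)) (h : (α : ℕ) < n), retr α w = g.1 ⟨α, h⟩) ∧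
      forget w = bar (g.1 ⟨n - 1, by omega⟩) := by
  constructor
  · rintro rfl
    refine ⟨fun α h => (eval_apply_of_lt w α h).symm, ?_⟩
    rw [eval_apply_last, bar_bar]
  · rintro ⟨h1, h2⟩
    apply Subtype.ext
    funext α
    rcases Nat.lt_or_ge α (n - 1) with h | h
    · exact (eval_apply_of_lt w ⟨α, h⟩ α.2).trans (h1 ⟨α, h⟩ α.2)
    · have hα : α = ⟨n - 1, by omega⟩ := Fin.ext (by have := α.2; simp; omega)
      rw [hα, eval_apply_last, h2, bar_bar]

theorem eval_relators (hn : 0 < n) (ρ : FreeGroup (Letter n r)) (h : ρ ∈ relators n r) :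
    eval n r ρ = 1 := by
  rw [eval_eq_iff hn]
  exact ⟨fun α _ => by simp [retr_relators α ρ h], by simp [forget_relators ρ h]⟩

/-- The abelianization of a word, as a vector of exponent sums. -/
def exponents : FreeGroup (Fin r) →* Multiplicative (Fin r → ℤ) :=
  FreeGroup.lift fun j => Multiplicative.ofAdd (Pi.single j (1 : ℤ) : Fin r → ℤ)

/-- The abelianization map factors through the vector of exponent sums. -/
theorem mem_commutator_of_exponents {u : FreeGroup (Fin r)} (hu : exponents u = 1) :
    u ∈ commutator (FreeGroup (Fin r)) := by
  have h : (Abelianization.of : FreeGroup (Fin r) →* _) =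
      (∏ i : Fin r, (zpowersHom (Abelianization (FreeGroup (Fin r)))
        (Abelianization.of (of i))).comp
        (AddMonoidHom.toMultiplicative (Pi.evalAddMonoidHom (fun _ : Fin r => ℤ) i))).comp
        exponents := by
    ext j
    simp only [MonoidHom.comp_apply, MonoidHom.finsetProd_apply, exponents, lift_apply_of]
    rw [Finset.prod_eq_single j]
    · simp
    · intro i _ hi
      simp [hi]
    · simp
  rw [← Abelianization.ker_of, MonoidHom.mem_ker, h, MonoidHom.comp_apply, hu, _root_.map_one]

theorem exponents_bar (u : FreeGroup (Fin r)) : exponents (bar u) = (exponents u)⁻¹ := by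
  have : exponents.comp bar = (exponents : FreeGroup (Fin r) →* _)⁻¹ := by
    ext i
    simp [exponents, bar]
  exact DFunLike.congr_fun this u

theorem prod_exponents (g : K n r) : ∏ α : Fin n, exponents (g.1 α) = 1 := by
  have h : psi n r g.1 = 1 := g.2
  rw [psi, MonoidHom.finsetProd_apply] at h
  exact h

/-- The first n - 1 coordinates of `g` serve as blocks, and the last one dictates the diagonal part
`d`. Membership in the kernel of `psi` makes the exponent sums of `d` vanish, so the retractions do
not see it. -/
theorem exists_eval_eq (hn : 0 < n) {δ : Fin r → Fin (n - 1)} (hδ : Function.Injective δ)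
    (g : K n r) : ∃ w, eval n r w = g := by
  obtain ⟨m, rfl⟩ : ∃ m, n = m + 1 := ⟨n - 1, by omega⟩
  let q : Fin (m + 1 - 1) → FreeGroup (Fin r) := fun α => g.1 (Fin.castSucc α)
  let d := bar (g.1 (Fin.last m)) * ((List.finRange (m + 1 - 1)).map q).prod⁻¹
  have hd : d ∈ commutator (FreeGroup (Fin r)) := by
    apply mem_commutator_of_exponents
    have h := prod_exponents g
    rw [Fin.prod_univ_castSucc, Fin.prod_univ_def, ← inv_eq_iff_mul_eq_one] at h
    rw [_root_.map_mul, exponents_bar, ← h, _root_.map_inv, map_list_prod, List.map_map, inv_inv]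
    exact mul_inv_cancel _
  refine ⟨color δ d * blocks (List.finRange _) q, ?_⟩
  rw [eval_eq_iff hn]
  refine ⟨fun α h => retr_color_mul_blocks hδ hd q α, ?_⟩
  rw [_root_.map_mul, forget_color, forget_blocks]
  exact inv_mul_cancel_right _ _

/-! ### Existence and uniqueness of normal forms; the presentation -/

/-- The colouring that gives the colour `i` to the `i`-th letter. -/
def diagonal (h : r ≤ n - 1) : Fin r → Fin (n - 1) := Fin.castLE h

theorem diagonal_injective (h : r ≤ n - 1) : Function.Injective (diagonal h) :=
  Fin.castLE_injective h

theorem range_color (τ : Fin r → Fin (n - 1)) :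
    (color τ).range = Subgroup.closure (Set.range fun i => x (τ i) i) :=
  FreeGroup.range_lift_eq_closure

theorem blockSubgroup_eq (α : Fin (n - 1)) :
    blockSubgroup n r α = (mono α : FreeGroup (Fin r) →* _).range := by
  rw [blockSubgroup, mono, range_color]
  congr 1
  ext w
  simp [eq_comm]

theorem diagonalSubgroup_eq (h : r ≤ n - 1) :
    diagonalSubgroup n r = (color (diagonal h)).range := by
  rw [diagonalSubgroup, range_color]
  congr 1
  ext w
  simp only [Set.mem_ofPred_eq, Set.mem_range]
  constructor
  · rintro ⟨α, i, hαi, rfl⟩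
    have : diagonal h i = α := Fin.ext hαi.symm
    exact ⟨i, by rw [this]⟩
  · rintro ⟨i, rfl⟩
    exact ⟨_, i, rfl, rfl⟩

theorem commutator_diagonalSubgroup (h : r ≤ n - 1) :
    ⁅diagonalSubgroup n r, diagonalSubgroup n r⁆ =
      (commutator (FreeGroup (Fin r))).map (color (diagonal h)) := by
  rw [diagonalSubgroup_eq h, MonoidHom.range_eq_map, commutator_def, Subgroup.map_commutator]

theorem IsNormalForm.eq_normalForm (h : r ≤ n - 1) {g : K n r} {v : FreeGroup (Letter n r)}
    (hv : IsNormalForm g v) : normalForm (diagonal h) v = v := by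
  obtain ⟨-, d, p, hd, hp, rfl⟩ := hv
  rw [commutator_diagonalSubgroup h] at hd
  obtain ⟨d, hd, rfl⟩ := hd
  simp only [blockSubgroup_eq] at hp
  choose q hq using hp
  have : (List.ofFn p).prod = blocks (List.finRange (n - 1)) q := by
    rw [blocks, List.ofFn_eq_map]
    congr 2
    funext α
    exact (hq α).symm
  rw [this]
  exact normalForm_color_mul_blocks (diagonal_injective h) hd q

theorem isNormalForm_normalForm (hn : 0 < n) (h : r ≤ n - 1) (w : FreeGroup (Letter n r)) :
    IsNormalForm (eval n r w) (normalForm (diagonal h) w) := by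
  refine ⟨?_, color (diagonal h) (defect w), fun α => mono α (retr α w), ?_, fun α => ?_, ?_⟩
  · rw [eval_eq_iff hn]
    obtain ⟨h1, h2⟩ := (eval_eq_iff hn w _).1 rfl
    exact ⟨fun α hα => (retr_normalForm (diagonal_injective h) w α).trans (h1 α hα),
      (forget_normalForm _ w).trans h2⟩
  · rw [commutator_diagonalSubgroup h]
    exact ⟨_, defect_mem_commutator w, rfl⟩
  · rw [blockSubgroup_eq]
    exact ⟨_, rfl⟩
  · rw [normalForm, blocks, List.ofFn_eq_map]

theorem normalForm_eq_of_eval_eq (hn : 0 < n) (δ : Fin r → Fin (n - 1))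
    {w v : FreeGroup (Letter n r)} (h : eval n r w = eval n r v) :
    normalForm δ w = normalForm δ v := by
  obtain ⟨h1, h2⟩ := (eval_eq_iff hn w _).1 h
  obtain ⟨h3, h4⟩ := (eval_eq_iff hn v _).1 rfl
  exact normalForm_congr δ
    (fun α => (h1 α (by omega)).trans (h3 α (by omega)).symm) (h2.trans h4.symm)

theorem existsUnique_isNormalForm (hn : 0 < n) (h : r ≤ n - 1) (g : K n r) :
    ∃! v, IsNormalForm g v := by
  obtain ⟨w, rfl⟩ := exists_eval_eq hn (diagonal_injective h) g
  refine ⟨normalForm (diagonal h) w, isNormalForm_normalForm hn h w, fun v hv => ?_⟩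
  rw [← hv.eq_normalForm h]
  exact normalForm_eq_of_eval_eq hn _ hv.1

theorem isPresentation_eval (hr : 0 < r) (hnr : r + 2 ≤ n) :
    IsPresentation (eval n r) (relators n r) := by
  have h : r ≤ n - 1 := by omega
  refine ⟨fun g => exists_eval_eq (by omega) (diagonal_injective h) g, le_antisymm ?_ ?_⟩
  · intro w hw
    obtain ⟨C, hC⟩ := near_normalForm hr hnr (diagonal_injective h)
    have h1 := hC w
    rw [normalForm_eq_of_eval_eq (by omega) _ (hw.trans (_root_.map_one _).symm), normalForm_one,
      Near, mul_one] at h1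
    rw [← inv_mem_iff]
    exact area_ne_top (ne_top_of_le_ne_top (ENat.natCast_ne_top _) h1.area_le)
  · exact Subgroup.normalClosure_le_normal fun ρ hρ => eval_relators (by omega) ρ hρ

theorem area_normalForm_le (hr : 0 < r) (hnr : r + 2 ≤ n) :
    ∃ C : ℕ, 0 < C ∧ ∀ (g : K n r) (w v : FreeGroup (Letter n r)), eval n r w = g →
      IsNormalForm g v → area (relators n r) (w⁻¹ * v) ≤ (C : ℕ∞) * (w.norm : ℕ∞) ^ 2 := by
  have h : r ≤ n - 1 := by omega
  obtain ⟨C, hC⟩ := near_normalForm hr hnr (diagonal_injective h)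
  refine ⟨C + 1, by omega, fun g w v hw hv => ?_⟩
  have h1 := (hC w).mono (M' := (C + 1) * w.norm ^ 2) (Nat.mul_le_mul_right _ (by omega))
  rw [normalForm_eq_of_eval_eq (by omega) _ (hw.trans hv.1.symm), hv.eq_normalForm h] at h1
  exact_mod_cast AreaLE.area_le h1

/-! ### The quadratic lower bound -/

/-- The integral Heisenberg group. -/
@[ext] structure Heisenberg where
  /-- The first coordinate. -/
  a : ℤ
  /-- The second coordinate. -/
  b : ℤ
  /-- The central coordinate. -/
  c : ℤ

namespace Heisenberg

instance : Mul Heisenberg := ⟨fun g h => ⟨g.a + h.a, g.b + h.b, g.c + h.c + g.a * h.b⟩⟩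

instance : One Heisenberg := ⟨⟨0, 0, 0⟩⟩

instance : Inv Heisenberg := ⟨fun g => ⟨-g.a, -g.b, -g.c + g.a * g.b⟩⟩

@[simp] theorem mul_a (g h : Heisenberg) : (g * h).a = g.a + h.a := rfl

@[simp] theorem mul_b (g h : Heisenberg) : (g * h).b = g.b + h.b := rfl

@[simp] theorem mul_c (g h : Heisenberg) : (g * h).c = g.c + h.c + g.a * h.b := rfl

@[simp] theorem one_a : (1 : Heisenberg).a = 0 := rfl

@[simp] theorem one_b : (1 : Heisenberg).b = 0 := rfl

@[simp] theorem one_c : (1 : Heisenberg).c = 0 := rfl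

@[simp] theorem inv_a (g : Heisenberg) : (g⁻¹).a = -g.a := rfl

@[simp] theorem inv_b (g : Heisenberg) : (g⁻¹).b = -g.b := rfl

@[simp] theorem inv_c (g : Heisenberg) : (g⁻¹).c = -g.c + g.a * g.b := rfl

instance : Group Heisenberg := Group.ofLeftAxioms
  (fun g h k => by ext <;> simp <;> ring)
  (fun g => by ext <;> simp)
  (fun g => by ext <;> simp)

theorem commutator_eq (g h : Heisenberg) : ⁅g, h⁆ = ⟨0, 0, g.a * h.b - h.a * g.b⟩ := by
  rw [commutatorElement_def]
  ext <;> simp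
  ring

theorem conj_central (g : Heisenberg) (c : ℤ) :
    g⁻¹ * (⟨0, 0, c⟩ : Heisenberg) * g = ⟨0, 0, c⟩ := by
  ext <;> simp
  ring

theorem pow_a (g : Heisenberg) (k : ℕ) : (g ^ k).a = k * g.a := by
  induction k with
  | zero => simp
  | succ k ih =>
    rw [pow_succ, mul_a, ih]
    push_cast
    ring

theorem pow_b (g : Heisenberg) (k : ℕ) : (g ^ k).b = k * g.b := by
  induction k with
  | zero => simp
  | succ k ih =>
    rw [pow_succ, mul_b, ih]
    push_cast
    ring

end Heisenberg

/-- The letters of index `j` in the colours `α` and `β` go to the standard generators of the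
Heisenberg group and all other letters to the identity. -/
def toHeisenberg (α β : Fin (n - 1)) (j : Fin r) : FreeGroup (Letter n r) →* Heisenberg :=
  FreeGroup.lift fun s =>
    ⟨if s.1 = α ∧ s.2 = j then 1 else 0, if s.1 = β ∧ s.2 = j then 1 else 0, 0⟩

/-- In a relator of the second kind at most one of the two distinct indices is `j`, so one entry of
the commutator maps to the identity. The first kind gives a determinant of 0/1 vectors. -/
theorem toHeisenberg_relators (α β : Fin (n - 1)) (j : Fin r)
    (ρ : FreeGroup (Letter n r)) (h : ρ ∈ relators n r) :
    ∃ c : ℤ, c ≤ 1 ∧ toHeisenberg α β j ρ = ⟨0, 0, c⟩ := by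
  rcases h with ⟨i, κ, μ, hne, rfl⟩ | ⟨i, k, κ, μ, ν, hik, h1, h2, h3, rfl⟩
  · refine ⟨_, ?_, by rw [map_commutatorElement, Heisenberg.commutator_eq]⟩
    simp only [toHeisenberg, x, lift_apply_of]
    split_ifs <;> norm_num
  · refine ⟨_, ?_, by rw [map_commutatorElement, Heisenberg.commutator_eq]⟩
    simp only [toHeisenberg, x, lift_apply_of, _root_.map_mul, _root_.map_inv, Heisenberg.mul_a,
      Heisenberg.mul_b, Heisenberg.inv_a, Heisenberg.inv_b]
    by_cases hi : i = j
    · have hk : k ≠ j := fun hk => hik (hi.trans hk.symm)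
      simp [hk]
    · simp [hi]

/-- Central elements are unchanged by conjugation and their coordinates add, so each factor
contributes at most 1. -/
theorem le_area_of_toHeisenberg (α β : Fin (n - 1)) (j : Fin r)
    {w : FreeGroup (Letter n r)} {m : ℕ} (hw : toHeisenberg α β j w = ⟨0, 0, m⟩) :
    (m : ℕ∞) ≤ area (relators n r) w := by
  refine le_sInf ?_
  rintro M ⟨l, h1, rfl, rfl⟩
  suffices h : ∃ c : ℤ, c ≤ l.length ∧
      toHeisenberg α β j (l.map fun p => p.1⁻¹ * p.2 * p.1).prod = ⟨0, 0, c⟩ by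
    obtain ⟨c, hc, h⟩ := h
    rw [h] at hw
    have : c = m := congrArg Heisenberg.c hw
    subst this
    exact_mod_cast hc
  clear hw
  induction l with
  | nil => exact ⟨0, by simp, by simp; rfl⟩
  | cons p l ih =>
    obtain ⟨c, hc, h⟩ := ih fun q hq => h1 q (List.mem_cons_of_mem _ hq)
    obtain ⟨c', hc', h'⟩ := toHeisenberg_relators α β j p.2 (h1 p List.mem_cons_self)
    refine ⟨c' + c, ?_, ?_⟩
    · simp only [List.length_cons]
      push_cast
      omega
    · rw [List.map_cons, List.prod_cons, _root_.map_mul, h, _root_.map_mul, _root_.map_mul,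
        _root_.map_inv, h', Heisenberg.conj_central]
      ext <;> simp

theorem sq_le_dehnFunction (hn : 3 ≤ n) (hr : 0 < r) (N : ℕ) :
    (N : ℕ∞) ^ 2 ≤ dehnFunction (eval n r) (relators n r) (4 * N) := by
  let α : Fin (n - 1) := ⟨0, by omega⟩
  let β : Fin (n - 1) := ⟨1, by omega⟩
  let j : Fin r := ⟨0, hr⟩
  have hαβ : α ≠ β := by simp [α, β]
  let w : FreeGroup (Letter n r) := ⁅x α j ^ N, x β j ^ N⁆
  have hnorm : ∀ γ : Fin (n - 1), (x γ j ^ N : FreeGroup (Letter n r)).norm ≤ N := by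
    intro γ
    rw [x, norm_of_pow]
  have hw : w.norm ≤ 4 * N := by
    have h1 := norm_mul_le (x α j ^ N * x β j ^ N * (x α j ^ N)⁻¹) (x β j ^ N)⁻¹
    have h2 := norm_conj_le (x α j ^ N) (x β j ^ N)
    have h3 : ((x β j ^ N)⁻¹ : FreeGroup (Letter n r)).norm = (x β j ^ N).norm := norm_inv_eq
    have h4 := hnorm α
    have h5 := hnorm β
    simp only [w, commutatorElement_def]
    omega
  have hw1 : eval n r w = 1 := by
    have h1 := eval_relators (by omega) _ (Or.inl ⟨j, α, β, hαβ, rfl⟩)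
    rw [map_commutatorElement, commutatorElement_eq_one_iff_commute] at h1
    rw [map_commutatorElement, commutatorElement_eq_one_iff_commute, map_pow, map_pow]
    exact h1.pow_pow N N
  have h1 : ((N ^ 2 : ℕ) : ℕ∞) ≤ area (relators n r) w := by
    refine le_area_of_toHeisenberg α β j ?_
    rw [map_commutatorElement, Heisenberg.commutator_eq, map_pow, map_pow]
    simp only [Heisenberg.pow_a, Heisenberg.pow_b, toHeisenberg, x, lift_apply_of]
    simp [hαβ, hαβ.symm, pow_two]
  calc (N : ℕ∞) ^ 2 = ((N ^ 2 : ℕ) : ℕ∞) := by push_cast; rfl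
    _ ≤ _ := h1
    _ ≤ _ := le_iSup₂_of_le (f := fun w _ => area (relators n r) w) w ⟨hw, hw1⟩ le_rfl

theorem dehnFunction_mono {S G : Type*} [DecidableEq S] [Group G] (φ : FreeGroup S →* G)
    (R : Set (FreeGroup S)) : Monotone (dehnFunction φ R) := fun _ _ h =>
  biSup_mono fun _ hw => ⟨hw.1.trans h, hw.2⟩

theorem asymp_dehnFunction (hr : 0 < r) (hn : 3 ≤ n) (hnr : r + 2 ≤ n) :
    Asymp (dehnFunction (eval n r) (relators n r)) (fun N => (N : ℕ∞) ^ 2) := by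
  constructor
  · obtain ⟨C, hC0, hC⟩ := area_normalForm_le hr hnr
    refine ⟨C, hC0, fun N => ?_⟩
    have h1 : dehnFunction (eval n r) (relators n r) N ≤ (C : ℕ∞) * (N : ℕ∞) ^ 2 := by
      refine iSup₂_le ?_
      rintro w ⟨hw, hw1⟩
      have h : r ≤ n - 1 := by omega
      have hnf := isNormalForm_normalForm (by omega) h (1 : FreeGroup (Letter n r))
      rw [normalForm_one, _root_.map_one] at hnf
      -- The area estimate concerns (word)⁻¹ · (normal form), so it is applied to `w⁻¹`, whose
      -- normal form is 1.
      have h2 := hC 1 w⁻¹ 1 (by rw [_root_.map_inv, hw1, inv_one]) hnf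
      have h3 : (w⁻¹).norm = w.norm := norm_inv_eq
      rw [inv_inv, mul_one, h3] at h2
      refine h2.trans ?_
      gcongr
    refine h1.trans ?_
    rw [add_assoc]
    refine le_trans ?_ le_self_add
    have : N ≤ C * N + C := by nlinarith
    have h2 : C * N ^ 2 ≤ C * (C * N + C) ^ 2 := by gcongr
    beta_reduce
    exact_mod_cast h2
  · refine ⟨4, by omega, fun N => ?_⟩
    rw [add_assoc]
    refine le_trans ?_ le_self_add
    refine (sq_le_dehnFunction hn hr N).trans ?_
    refine (dehnFunction_mono _ _ (by omega : 4 * N ≤ 4 * N + 4)).trans ?_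
    exact le_mul_of_one_le_left zero_le (by norm_num)

end Coabelian

theorem mainTheorem5 (n r : ℕ) (hn : 4 ≤ n) (hr : 2 ≤ r) (hnr : r + 2 ≤ n) :
    Dehn.IsPresentation (Coabelian.eval n r) (Coabelian.relators n r) ∧
    (∀ g : Coabelian.K n r, ∃! v : FreeGroup (Coabelian.Letter n r),
      Coabelian.IsNormalForm g v) ∧
    (∃ C : ℕ, 0 < C ∧ ∀ (g : Coabelian.K n r) (w v : FreeGroup (Coabelian.Letter n r)),
      Coabelian.eval n r w = g → Coabelian.IsNormalForm g v →
        Dehn.area (Coabelian.relators n r) (w⁻¹ * v) ≤ (C : ℕ∞) * (w.norm : ℕ∞) ^ 2) ∧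
    Dehn.Asymp (Dehn.dehnFunction (Coabelian.eval n r) (Coabelian.relators n r))
      (fun N => (N : ℕ∞) ^ 2) :=
  ⟨Coabelian.isPresentation_eval (by omega) hnr,
    Coabelian.existsUnique_isNormalForm (by omega) (by omega),
    Coabelian.area_normalForm_le (by omega) hnr,
    Coabelian.asymp_dehnFunction (by omega) (by omega) hnr⟩
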